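/- Let $n,\ell\in\mathbb N$ and let $\theta\in\mathbb R$ with $\sin\theta\neq 0$. For $f\in L^1(\mathbb R^n)$ put \[ \mathscr F_\theta f(\omega)=\frac{1}{|\sin\theta|^{n/2}}\int_{\mathbb R^n} f(t)\,e^{-\pi i\left((|t|^2+|\omega|^2)\cot\theta-2\,\omega\cdot t\,\csc\theta\right)}\,dt , \] and denote by $\mathscr F_\theta$ also the extension of this transform from $L^1\cap L^2$ to a unitary operator on $L^2(\mathbb R^n)$ (complex-valued functions). For $s\in\mathbb R^n$ let $T_s^\theta f(t)=e^{2\pi i\,s\cdot(t-s)\cot\theta}f(t-s)$, and call a subspace $V\subset L^2(\mathbb R^n)$ $\theta$-translation invariant if $T^\theta_sV\subset V$ for all $s\in\mathbb R^n$. A family $(v_i)_{i\in I}$ in a Hilbert space is a Riesz basis of a closed subspace $V$ if its closed linear span is $V$ and there are $0<C_1\le C_2<\infty$ with $C_1\sum|c_i|^2\le\|\sum c_iv_i\|^2\le C_2\sum|c_i|^2$ for all finitely supported $(c_i)$. Let $\mathcal T^{\ell,\theta}$ be the set of all closed subspaces $V$ of $L^2(\mathbb R^n)$ for which there are $\phi_1,\dots,\phi_\ell\in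 L^2(\mathbb R^n)$ such that the family $(T_k^\theta\phi_j)_{k\in\mathbb Z^n,\,1\le j\le\ell}$ is a Riesz basis of $V$. A set $\Omega\subset\mathbb R^n$ is a fractional $\ell$-multi-tile if \[ \sum_{t\in\mathbb Z^n\sin\theta}\chi_\Omega(\omega+t)=\ell\qquad\text{for a.e. }\omega\in\mathbb R^n , \] and for measurable $\Omega$ put $V^\theta_\Omega=\{f\in L^2(\mathbb R^n):\mathscr F_\theta f(\omega)=0\text{ for a.e. }\omega\in\mathbb R^n\setminus\Omega\}$. Then, for a subspace $V$ of $L^2(\mathbb R^n)$, the following are equivalent: (a) $V\in\mathcal T^{\ell,\theta}$ and $V$ is $\theta$-translation invariant; (b) $V=V^\theta_\Omega$ for some measurable fractional $\ell$-multi-tile $\Omega\subset\mathbb R^n$. -/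

import Mathlib

open MeasureTheory Filter Topology
open scoped ENNReal FourierTransform RealInnerProductSpace

noncomputable section

namespace FrFT

/-- Euclidean space `ℝⁿ`. -/
abbrev E (n : ℕ) : Type := EuclideanSpace ℝ (Fin n)

/-- The Hilbert space `L²(ℝⁿ)` of complex-valued square integrable functions (modulo null sets). -/
abbrev L2 (n : ℕ) : Type := Lp ℂ 2 (volume : Measure (E n))

/-- The vector `k ∈ ℤⁿ`, regarded as a point of `ℝⁿ`. -/
def intVec {n : ℕ} (k : Fin n → ℤ) : E n := WithLp.toLp 2 (fun i => (k i : ℝ))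

/-- The `θ`-translation by `s` on functions:
`T_s^θ f (t) = exp (2 π i s·(t - s) cot θ) f (t - s)`. -/
def thetaTranslateFun {n : ℕ} (θ : ℝ) (s : E n) (f : E n → ℂ) (t : E n) : ℂ :=
  Complex.exp (((2 * Real.pi * ⟪s, t - s⟫ * Real.cot θ : ℝ) : ℂ) * Complex.I) * f (t - s)

lemma memLp_thetaTranslateFun {n : ℕ} (θ : ℝ) (s : E n) (f : L2 n) :
    MemLp (thetaTranslateFun θ s f) 2 (volume : Measure (E n)) := by
  have h1 : MemLp (fun t : E n => f (t - s)) 2 volume :=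
    (Lp.memLp f).comp_measurePreserving (measurePreserving_sub_right volume s)
  refine MemLp.of_le h1 ?_ ?_
  · refine AEStronglyMeasurable.mul (Continuous.aestronglyMeasurable ?_) h1.1
    fun_prop
  · refine Eventually.of_forall fun t => ?_
    simp only [thetaTranslateFun, norm_mul, Complex.norm_exp_ofReal_mul_I, one_mul, le_refl]

/-- The `θ`-translation `T_s^θ` on `L²(ℝⁿ)`. -/
def thetaTranslate {n : ℕ} (θ : ℝ) (s : E n) (f : L2 n) : L2 n :=
  (memLp_thetaTranslateFun θ s f).toLp (thetaTranslateFun θ s f)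

/-- Chirp multiplication on functions: `t ↦ exp (-π i |t|² cot θ) f (t)`. -/
def chirpFun {n : ℕ} (θ : ℝ) (f : E n → ℂ) (t : E n) : ℂ :=
  Complex.exp (((-(Real.pi * ‖t‖ ^ 2 * Real.cot θ) : ℝ) : ℂ) * Complex.I) * f t

lemma memLp_chirpFun {n : ℕ} (θ : ℝ) (f : L2 n) :
    MemLp (chirpFun θ f) 2 (volume : Measure (E n)) := by
  refine MemLp.of_le (Lp.memLp f) ?_ ?_
  · refine AEStronglyMeasurable.mul (Continuous.aestronglyMeasurable ?_) (Lp.memLp f).1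
    fun_prop
  · refine Eventually.of_forall fun t => ?_
    simp only [chirpFun, norm_mul, Complex.norm_exp_ofReal_mul_I, one_mul, le_refl]

/-- Chirp multiplication on `L²(ℝⁿ)`. -/
def chirp {n : ℕ} (θ : ℝ) (f : L2 n) : L2 n :=
  (memLp_chirpFun θ f).toLp (chirpFun θ f)

/-- The fractional Fourier transform of an integrable function, for `sin θ ≠ 0`:
`|sin θ|^(-n/2) ∫ f(t) exp (-π i ((|t|² + |ω|²) cot θ - 2 ω·t csc θ)) dt`. -/
def frftIntegral {n : ℕ} (θ : ℝ) (f : E n → ℂ) (ω : E n) : ℂ :=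
  ((|Real.sin θ| ^ (-(n : ℝ) / 2) : ℝ) : ℂ) *
    ∫ t : E n, f t * Complex.exp (((-(Real.pi * ((‖t‖ ^ 2 + ‖ω‖ ^ 2) * Real.cot θ
      - 2 * ⟪ω, t⟫ * (Real.sin θ)⁻¹)) : ℝ) : ℂ) * Complex.I)

/-- The fractional Fourier transform on `L²(ℝⁿ)`, for `sin θ ≠ 0`, as a function defined almost
everywhere.  It is the chirp `exp (-π i |ω|² cot θ)` times the dilation by `csc θ` of the Plancherel
(inverse) Fourier transform of the chirp-multiplied function, normalised by `|sin θ|^(-n/2)`;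
`frft_ae_eq_frftIntegral` shows that it is given by the integral on `L¹ ∩ L²`, of which it is
therefore the continuous extension. -/
def frft {n : ℕ} (θ : ℝ) (f : L2 n) : E n → ℂ :=
  fun ω => ((|Real.sin θ| ^ (-(n : ℝ) / 2) : ℝ) : ℂ) *
    chirpFun θ (fun ξ => (𝓕⁻ (chirp θ f) : L2 n) ((Real.sin θ)⁻¹ • ξ)) ω

/-- On `L¹ ∩ L²`, the Plancherel inverse Fourier transform is given by the Fourier integral. -/
lemma fourierInv_ae_eq_integral {n : ℕ} (f : L2 n) (hf : Integrable f (volume : Measure (E n))) :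
    (𝓕⁻ f : L2 n) =ᵐ[volume] 𝓕⁻ (f : E n → ℂ) := by
  have hcont : Continuous (𝓕⁻ (f : E n → ℂ)) := by
    rw [Real.fourierInv_eq_fourier_comp_neg]
    exact VectorFourier.fourierIntegral_continuous Real.continuous_fourierChar
      (by exact continuous_inner) hf.comp_neg
  refine ae_eq_of_integral_contDiff_smul_eq
    ((Lp.memLp _).locallyIntegrable one_le_two) hcont.locallyIntegrable ?_
  intro g g_smooth g_cpt
  have hg₁ : HasCompactSupport (Complex.ofRealCLM ∘ g) := g_cpt.comp_left rfl
  have hg₂ : ContDiff ℝ (⊤ : ℕ∞) (Complex.ofRealCLM ∘ g) := by fun_prop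
  set G : SchwartzMap (E n) ℂ := hg₁.toSchwartzMap hg₂
  have hG : ∀ x, G x = (g x : ℂ) := fun x => rfl
  have key := congrArg (fun T => T G) (Lp.fourierInv_toTemperedDistribution_eq f)
  simp only [TemperedDistribution.fourierInv_apply, Lp.toTemperedDistribution_apply] at key
  have h2 : ∫ x, (𝓕⁻ G) x • f x = ∫ x, G x • 𝓕⁻ (f : E n → ℂ) x := by
    have := VectorFourier.integral_fourierIntegral_smul_eq_flip (L := -innerₗ (E n))
      (μ := volume) (ν := volume) (f := G) (g := f) Real.continuous_fourierChar
      (by exact continuous_inner.neg) G.integrable hf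
    rw [SchwartzMap.fourierInv_coe]
    have e1 : ∀ x, 𝓕⁻ (G : E n → ℂ) x =
        VectorFourier.fourierIntegral Real.fourierChar volume (-innerₗ (E n)) G x := by
      intro x
      simp [Real.fourierInv_eq, VectorFourier.fourierIntegral]
    have e2 : ∀ x, 𝓕⁻ (f : E n → ℂ) x =
        VectorFourier.fourierIntegral Real.fourierChar volume (-innerₗ (E n)).flip f x := by
      intro x
      simp [Real.fourierInv_eq, VectorFourier.fourierIntegral, real_inner_comm]
    simp only [e1, e2]
    exact this
  have h3 := key.symm.trans h2
  simpa [hG] using h3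

/-- On `L¹ ∩ L²`, the fractional Fourier transform is given by the integral. -/
lemma frft_ae_eq_frftIntegral {n : ℕ} {θ : ℝ} (hθ : Real.sin θ ≠ 0) (f : L2 n)
    (hf : Integrable f (volume : Measure (E n))) :
    frft θ f =ᵐ[volume] frftIntegral θ f := by
  have hc : chirp θ f =ᵐ[volume] chirpFun θ f := (memLp_chirpFun θ f).coeFn_toLp
  have hint : Integrable (chirp θ f) (volume : Measure (E n)) := by
    refine hf.mono (Lp.aestronglyMeasurable _) ?_
    filter_upwards [hc] with t ht
    rw [ht]
    simp only [chirpFun, norm_mul, Complex.norm_exp_ofReal_mul_I, one_mul, le_refl]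
  have h1 := fourierInv_ae_eq_integral (chirp θ f) hint
  have hq : Measure.QuasiMeasurePreserving (fun ω : E n => (Real.sin θ)⁻¹ • ω)
      volume volume := by
    refine ⟨by fun_prop, ?_⟩
    rw [Measure.map_addHaar_smul _ (inv_ne_zero hθ)]
    exact Measure.smul_absolutelyContinuous
  filter_upwards [hq.ae h1] with ω hω
  simp only [frft, chirpFun, frftIntegral, hω, Real.fourierInv_eq']
  rw [← integral_const_mul]
  congr 1
  refine integral_congr_ae ?_
  filter_upwards [hc] with t ht
  rw [ht, chirpFun, smul_eq_mul, mul_comm (f t)]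
  simp only [← mul_assoc, ← Complex.exp_add]
  congr 2
  rw [inner_smul_right, real_inner_comm]
  push_cast
  ring

/-- The space of `L²` functions whose fractional Fourier transform vanishes almost everywhere
outside `Ω`. -/
def bandlimited {n : ℕ} (θ : ℝ) (Ω : Set (E n)) : Set (L2 n) :=
  {f | ∀ᵐ ω ∂(volume : Measure (E n)), ω ∉ Ω → frft θ f ω = 0}

/-- `Ω` tiles `ℝⁿ` at level `ℓ` when translated by `L`. -/
def TilesAtLevel {n : ℕ} (Ω L : Set (E n)) (ℓ : ℕ) : Prop :=
  ∀ᵐ ω ∂(volume : Measure (E n)), ∑' t : L, Ω.indicator (fun _ => (1 : ℝ≥0∞)) (ω + t) = ℓ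

/-- The set `ℤⁿ sin θ`. -/
def lattice (n : ℕ) (θ : ℝ) : Set (E n) := Set.range fun k : Fin n → ℤ => Real.sin θ • intVec k

/-- `Ω` is a fractional `ℓ`-multi-tile: it tiles `ℝⁿ` at level `ℓ` when translated by
`ℤⁿ sin θ`. -/
def IsFractionalMultiTile {n : ℕ} (θ : ℝ) (ℓ : ℕ) (Ω : Set (E n)) : Prop :=
  TilesAtLevel Ω (lattice n θ) ℓ

/-- The indexed family `v` is a Riesz basis of the subspace `V`. -/
def IsRieszBasis {ι H : Type*} [NormedAddCommGroup H] [InnerProductSpace ℂ H] (v : ι → H)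
    (V : Submodule ℂ H) : Prop :=
  (Submodule.span ℂ (Set.range v)).topologicalClosure = V ∧
  ∃ C₁ C₂ : ℝ, 0 < C₁ ∧ C₁ ≤ C₂ ∧ ∀ c : ι →₀ ℂ,
    C₁ * (c.sum fun _ a => ‖a‖ ^ 2) ≤ ‖c.sum fun i a => a • v i‖ ^ 2 ∧
    ‖c.sum fun i a => a • v i‖ ^ 2 ≤ C₂ * (c.sum fun _ a => ‖a‖ ^ 2)

/-- `V` is invariant under all `θ`-translations `T_s^θ`, `s ∈ ℝⁿ`. -/
def IsThetaTranslationInvariant {n : ℕ} (θ : ℝ) (V : Submodule ℂ (L2 n)) : Prop :=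
  ∀ s : E n, ∀ f ∈ V, thetaTranslate θ s f ∈ V

/-- The class `𝒯^{ℓ,θ}`: the spaces `V` having `ℓ` generators `φ₁, …, φ_ℓ` for which the family
of integer `θ`-shifts `T_k^θ φ_j`, `k ∈ ℤⁿ`, `1 ≤ j ≤ ℓ`, is a Riesz basis of `V` (in particular
`V` is the closed linear span of this family). -/
def 𝒯 (n ℓ : ℕ) (θ : ℝ) : Set (Submodule ℂ (L2 n)) :=
  {V | ∃ φ : Fin ℓ → L2 n,
    IsRieszBasis (fun p : (Fin n → ℤ) × Fin ℓ => thetaTranslate θ (intVec p.1) (φ p.2)) V}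

end FrFT

end

/-!
The operator `f ↦ 𝓕⁻¹ (exp (-π i |t|² cot θ) f)` is unitary, and it turns the `θ`-translation `T_s^θ`
into the modulation `M_s` (multiplication by `exp (2 π i s·x)`), up to a constant phase; up to a
dilation by `sin θ` and unimodular factors it is the fractional Fourier transform. Hence the theorem
is equivalent to `exists_isRieszBasis_and_modulation_mem_iff`, which concerns modulations only: a
subspace `W` of `L²(ℝⁿ)` is invariant under all modulations and has a Riesz basis `M_k g_j`,
`k ∈ ℤⁿ`, `j ≤ ℓ`, if and only if `W = L²(Ω)` for a set `Ω` that meets almost every orbit `x + ℤⁿ`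
in exactly `ℓ` points.

*From Riesz bases to sets.* If `W` is closed and invariant under all modulations, then for `f ∈ W`
and `g ∈ Wᗮ` the Fourier transform of the integrable function `f · conj g` vanishes, so `f` and `g`
have disjoint supports. Projecting a nowhere vanishing function to `W` gives a set `Ω` with
`W = L²(Ω)` (`exists_eq_supportedOn_of_modulation_mem`). The multiplicity of `Ω` is read off from the
fibres `(f (x + k))_k`. Fibres of functions in the closed span of the `M_k g_j` are linear
combinations of the fibres of the `g_j` (`ae_fiber_mem_span`), so an orbit meets `Ω` in at most `ℓ`
points (`ae_encard_le`). Conversely, `ℤⁿ`-periodic indicator functions are limits of trigonometric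
polynomials (`cutoff_mem_closure_trigMul`), so the lower Riesz bound localises to a lower bound for
the fibres (`ae_le_fiberNormSq`). The fibres of the `g_j` are thus linearly independent, and there
are at least `ℓ` points (`ae_le_encard`).

*From sets to Riesz bases.* Ordering each orbit lexicographically splits `Ω` into `ℓ` tiles, each
meeting almost every orbit exactly once (`isTile_layer`). For a tile `D` the functions `M_k χ_D` are
an orthonormal basis of `L²(D)` (`IsTile.orthonormal`, `IsTile.ae_eq_zero_of_inner_eq_zero`).
-/

noncomputable section

namespace FrFT

variable {n : ℕ}

/-! ### Multiplication operators and modulations -/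

lemma memLp_mul_of_norm_eq_one {u : E n → ℂ} (hu : Continuous u) (h1 : ∀ x, ‖u x‖ = 1) (f : L2 n) :
    MemLp (fun x => u x * f x) 2 (volume : Measure (E n)) := by
  refine MemLp.of_le (Lp.memLp f) (hu.aestronglyMeasurable.mul (Lp.memLp f).1) ?_
  exact Eventually.of_forall fun t => by rw [norm_mul, h1, one_mul]

/-- Multiplication by a continuous unimodular function, as an isometry of `L²(ℝⁿ)`. -/
def unimodularMul (u : E n → ℂ) (hu : Continuous u) (h1 : ∀ x, ‖u x‖ = 1) : L2 n →ₗᵢ[ℂ] L2 n where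
  toFun f := (memLp_mul_of_norm_eq_one hu h1 f).toLp _
  map_add' f g := by
    ext1
    filter_upwards [(memLp_mul_of_norm_eq_one hu h1 (f + g)).coeFn_toLp,
      (memLp_mul_of_norm_eq_one hu h1 f).coeFn_toLp, (memLp_mul_of_norm_eq_one hu h1 g).coeFn_toLp,
      Lp.coeFn_add f g, Lp.coeFn_add ((memLp_mul_of_norm_eq_one hu h1 f).toLp _)
        ((memLp_mul_of_norm_eq_one hu h1 g).toLp _)] with x a b c d e
    rw [a, e, Pi.add_apply, b, c, d, Pi.add_apply, mul_add]
  map_smul' z f := by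
    ext1
    filter_upwards [(memLp_mul_of_norm_eq_one hu h1 (z • f)).coeFn_toLp,
      (memLp_mul_of_norm_eq_one hu h1 f).coeFn_toLp,
      Lp.coeFn_smul z f, Lp.coeFn_smul z ((memLp_mul_of_norm_eq_one hu h1 f).toLp _)]
      with x a b c d
    rw [a, RingHom.id_apply, d, Pi.smul_apply, b, c, Pi.smul_apply, smul_eq_mul, smul_eq_mul,
      mul_left_comm]
  norm_map' f := by
    simp only [LinearMap.coe_mk, AddHom.coe_mk, Lp.norm_toLp]
    rw [Lp.norm_def]
    congr 1
    exact eLpNorm_congr_norm_ae (Eventually.of_forall fun t => by rw [norm_mul, h1, one_mul])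

lemma coeFn_unimodularMul (u : E n → ℂ) (hu : Continuous u) (h1 : ∀ x, ‖u x‖ = 1) (f : L2 n) :
    unimodularMul u hu h1 f =ᵐ[volume] fun x => u x * f x :=
  (memLp_mul_of_norm_eq_one hu h1 f).coeFn_toLp

/-- The character `x ↦ exp (2 π i s·x)` of `ℝⁿ`. -/
def char (s x : E n) : ℂ := Complex.exp (((2 * Real.pi * ⟪s, x⟫ : ℝ) : ℂ) * Complex.I)

lemma continuous_char (s : E n) : Continuous (char s) := by
  unfold char
  fun_prop

lemma norm_char (s x : E n) : ‖char s x‖ = 1 := Complex.norm_exp_ofReal_mul_I _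

lemma char_add_left (s t x : E n) : char (s + t) x = char s x * char t x := by
  simp only [char, ← Complex.exp_add, inner_add_left]
  push_cast
  ring_nf

lemma char_add_right (s x y : E n) : char s (x + y) = char s x * char s y := by
  simp only [char, ← Complex.exp_add, inner_add_right]
  push_cast
  ring_nf

lemma char_neg (s x : E n) : char (-s) x = (starRingEnd ℂ) (char s x) := by
  simp only [char, ← Complex.exp_conj, map_mul, Complex.conj_I, Complex.conj_ofReal, inner_neg_left]
  push_cast
  ring_nf

/-- Modulation by `s`: multiplication by the character `exp (2 π i s·x)`. -/
def modulation (s : E n) : L2 n →ₗᵢ[ℂ] L2 n :=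
  unimodularMul (char s) (continuous_char s) (norm_char s)

lemma coeFn_modulation (s : E n) (f : L2 n) :
    modulation s f =ᵐ[volume] fun x => char s x * f x :=
  coeFn_unimodularMul _ _ _ f

/-- The subspace of `L²(ℝⁿ)` of functions vanishing almost everywhere outside `Ω`. -/
def supportedOn (Ω : Set (E n)) : Submodule ℂ (L2 n) where
  carrier := {f | ∀ᵐ x, x ∉ Ω → f x = 0}
  zero_mem' := by
    filter_upwards [Lp.coeFn_zero ℂ 2 (volume : Measure (E n))] with x hx _
    rw [hx, Pi.zero_apply]
  add_mem' {f g} hf hg := by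
    filter_upwards [hf, hg, Lp.coeFn_add f g] with x h1 h2 h3 hx
    rw [h3, Pi.add_apply, h1 hx, h2 hx, add_zero]
  smul_mem' c f hf := by
    filter_upwards [hf, Lp.coeFn_smul c f] with x h1 h2 hx
    rw [h2, Pi.smul_apply, h1 hx, smul_zero]

lemma mem_supportedOn {Ω : Set (E n)} {f : L2 n} :
    f ∈ supportedOn Ω ↔ ∀ᵐ x, x ∉ Ω → f x = 0 := Iff.rfl

lemma modulation_mem_supportedOn {Ω : Set (E n)} (s : E n) {f : L2 n} (hf : f ∈ supportedOn Ω) :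
    modulation s f ∈ supportedOn Ω := by
  filter_upwards [mem_supportedOn.1 hf, coeFn_modulation s f] with x h1 h2 hx
  rw [h2, h1 hx, mul_zero]

/-- An `L²`-convergent sequence has a subsequence converging almost everywhere; hence closures in
`L²` can be tested by almost everywhere convergent sequences. -/
lemma exists_seq_tendsto_ae_of_mem_closure {S : Set (L2 n)} {f : L2 n} (hf : f ∈ closure S) :
    ∃ u : ℕ → L2 n, (∀ m, u m ∈ S) ∧ ∀ᵐ x, Tendsto (fun m => u m x) atTop (𝓝 (f x)) := by
  obtain ⟨u, hu, hlim⟩ := mem_closure_iff_seq_limit.1 hf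
  obtain ⟨ns, -, h⟩ := (tendstoInMeasure_of_tendsto_Lp hlim).exists_seq_tendsto_ae
  exact ⟨fun m => u (ns m), fun m => hu _, h⟩

lemma isClosed_supportedOn (Ω : Set (E n)) : IsClosed (supportedOn Ω : Set (L2 n)) := by
  refine isClosed_of_closure_subset fun f hf => ?_
  obtain ⟨u, hu, hlim⟩ := exists_seq_tendsto_ae_of_mem_closure hf
  have : ∀ᵐ x, ∀ m, x ∉ Ω → u m x = 0 := ae_all_iff.2 hu
  refine mem_supportedOn.2 ?_
  filter_upwards [this, hlim] with x h1 h2 hx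
  refine tendsto_nhds_unique h2 ?_
  simp only [h1 _ hx, tendsto_const_nhds]

/-! ### Modulation invariant subspaces -/

/-- The Fourier transform is injective on `L¹`. -/
lemma ae_eq_zero_of_integral_char_mul_eq_zero {h : E n → ℂ} (hh : Integrable h)
    (h0 : ∀ s, ∫ x, char s x * h x = 0) : ∀ᵐ x, h x = 0 := by
  have hF : ∀ s, 𝓕⁻ h s = 0 := by
    intro s
    rw [← h0 s, Real.fourierInv_eq']
    refine integral_congr_ae (Eventually.of_forall fun x => ?_)
    simp only [char, real_inner_comm, smul_eq_mul]
  refine ae_eq_zero_of_integral_contDiff_smul_eq_zero hh.locallyIntegrable ?_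
  intro g g_smooth g_cpt
  have hg₁ : HasCompactSupport (Complex.ofRealCLM ∘ g) := g_cpt.comp_left rfl
  have hg₂ : ContDiff ℝ (⊤ : ℕ∞) (Complex.ofRealCLM ∘ g) := by fun_prop
  set G : SchwartzMap (E n) ℂ := hg₁.toSchwartzMap hg₂
  have hG : ∀ x, G x = (g x : ℂ) := fun x => rfl
  have h2 : ∫ x, (𝓕⁻ (𝓕 G)) x • h x = ∫ x, (𝓕 G) x • 𝓕⁻ h x := by
    have := VectorFourier.integral_fourierIntegral_smul_eq_flip (L := -innerₗ (E n))
      (μ := volume) (ν := volume) (f := (𝓕 G : SchwartzMap (E n) ℂ)) (g := h) Real.continuous_fourierChar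
      (by exact continuous_inner.neg) (SchwartzMap.integrable _) hh
    rw [SchwartzMap.fourierInv_coe]
    have e1 : ∀ x, 𝓕⁻ ((𝓕 G : SchwartzMap (E n) ℂ) : E n → ℂ) x =
        VectorFourier.fourierIntegral Real.fourierChar volume (-innerₗ (E n))
          (𝓕 G : SchwartzMap (E n) ℂ) x := by
      intro x
      simp [Real.fourierInv_eq, VectorFourier.fourierIntegral]
    have e2 : ∀ x, 𝓕⁻ h x =
        VectorFourier.fourierIntegral Real.fourierChar volume (-innerₗ (E n)).flip h x := by
      intro x
      simp [Real.fourierInv_eq, VectorFourier.fourierIntegral, real_inner_comm]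
    simp only [e1, e2]
    exact this
  rw [FourierTransform.fourierInv_fourier_eq] at h2
  simpa [hF, hG] using h2

/-- If all modulations of `f` are orthogonal to `g`, the supports of `f` and `g` are disjoint. -/
lemma ae_eq_zero_or_of_inner_modulation_eq_zero {f g : L2 n}
    (h : ∀ s, inner ℂ g (modulation s f) = 0) : ∀ᵐ x, f x = 0 ∨ g x = 0 := by
  have key := ae_eq_zero_of_integral_char_mul_eq_zero (L2.integrable_inner (𝕜 := ℂ) g f) (by
    intro s
    rw [← h s, L2.inner_def]
    refine integral_congr_ae ?_
    filter_upwards [coeFn_modulation s f] with x hx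
    simp only [hx, RCLike.inner_apply]
    ring)
  filter_upwards [key] with x hx
  simpa [RCLike.inner_apply] using hx

lemma exists_L2_ne_zero (n : ℕ) : ∃ h : L2 n, ∀ᵐ x, h x ≠ 0 := by
  have hint : Integrable (fun x : E n => Complex.exp (-(1 : ℂ) * ‖x‖ ^ 2)) := by
    have := GaussianFourier.integrable_cexp_neg_mul_sq_norm_add (b := 1) (by simp) 0 (0 : E n)
    simpa using this
  have hc : Continuous fun x : E n => Complex.exp (-(1 : ℂ) * ‖x‖ ^ 2) := by fun_prop
  have hm : MemLp (fun x : E n => Complex.exp (-(1 : ℂ) * ‖x‖ ^ 2)) 2 volume := by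
    refine (memLp_two_iff_integrable_sq_norm hc.aestronglyMeasurable).2 ?_
    refine hint.mono (by fun_prop) (Eventually.of_forall fun x => ?_)
    have h1 : ‖Complex.exp (-(1 : ℂ) * ‖x‖ ^ 2)‖ ≤ 1 := by
      rw [Complex.norm_exp]
      refine Real.exp_le_one_iff.2 ?_
      have : (-(1 : ℂ) * ‖x‖ ^ 2).re = -‖x‖ ^ 2 := by norm_cast; simp
      rw [this]
      nlinarith [sq_nonneg ‖x‖]
    rw [norm_pow, norm_norm]
    nlinarith [norm_nonneg (Complex.exp (-(1 : ℂ) * ‖x‖ ^ 2))]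
  refine ⟨hm.toLp _, ?_⟩
  filter_upwards [hm.coeFn_toLp] with x hx
  rw [hx]
  exact Complex.exp_ne_zero _

/-- Wiener's theorem: a closed subspace of `L²(ℝⁿ)` invariant under all modulations consists of
all functions supported on some measurable set. -/
theorem exists_eq_supportedOn_of_modulation_mem (W : Submodule ℂ (L2 n))
    (hW : IsClosed (W : Set (L2 n))) (hinv : ∀ s, ∀ f ∈ W, modulation s f ∈ W) :
    ∃ Ω : Set (E n), MeasurableSet Ω ∧ W = supportedOn Ω := by
  have : CompleteSpace W := hW.completeSpace_coe
  have disj : ∀ f ∈ W, ∀ g ∈ Wᗮ, ∀ᵐ x, f x = 0 ∨ g x = 0 := fun f hf g hg =>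
    ae_eq_zero_or_of_inner_modulation_eq_zero fun s =>
      Submodule.inner_left_of_mem_orthogonal (hinv s f hf) hg
  have dec : ∀ f : L2 n, ∃ p ∈ W, ∃ q ∈ Wᗮ, ∀ᵐ x, f x = p x + q x := by
    intro f
    refine ⟨W.starProjection f, Submodule.starProjection_apply_mem _ _,
      f - W.starProjection f, Submodule.sub_starProjection_mem_orthogonal _, ?_⟩
    filter_upwards [Lp.coeFn_sub f (W.starProjection f)] with x hx
    rw [hx, Pi.sub_apply]
    ring
  obtain ⟨h, hh⟩ := exists_L2_ne_zero n
  -- the support of the projection to `W` of a nowhere vanishing function is the required set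
  obtain ⟨p, hp, q, hq, hpq⟩ := dec h
  refine ⟨{x | p x ≠ 0}, (Lp.stronglyMeasurable p).measurable (measurableSet_singleton 0).compl, ?_⟩
  apply le_antisymm
  · intro f hf
    refine mem_supportedOn.2 ?_
    filter_upwards [disj f hf q hq, hpq, hh] with x h1 h2 h3 h4
    have h4 : p x = 0 := not_not.1 h4
    rw [h4, zero_add] at h2
    exact h1.resolve_right (h2 ▸ h3)
  · intro f hf
    obtain ⟨a, ha, b, hb, hab⟩ := dec f
    have hfa : f = a := by
      ext1
      filter_upwards [mem_supportedOn.1 hf, disj a ha q hq, disj p hp b hb, hpq, hh, hab]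
        with x h1 h2 h3 h4 h5 h6
      by_cases hpx : p x = 0
      · have : q x ≠ 0 := by rw [hpx, zero_add] at h4; exact h4 ▸ h5
        rw [h1 (not_not.2 hpx), h2.resolve_right this]
      · rw [h6, h3.resolve_left hpx, add_zero]
    exact hfa ▸ ha

/-! ### The action of the integer lattice -/

lemma intVec_apply (k : Fin n → ℤ) (i : Fin n) : intVec k i = k i := rfl

lemma intVec_zero : intVec (0 : Fin n → ℤ) = 0 := by
  ext i; simp [intVec_apply]

lemma intVec_add (k m : Fin n → ℤ) : intVec (k + m) = intVec k + intVec m := by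
  ext i; simp [intVec_apply]

lemma intVec_neg (k : Fin n → ℤ) : intVec (-k) = -intVec k := by
  ext i; simp [intVec_apply]

lemma intVec_injective : Function.Injective (intVec : (Fin n → ℤ) → E n) := by
  intro k m h
  funext i
  have := congrArg (fun v : E n => v i) h
  simpa [intVec_apply] using this

lemma char_intVec_add_intVec (k m : Fin n → ℤ) (x : E n) :
    char (intVec k) (x + intVec m) = char (intVec k) x := by
  rw [char_add_right]
  have : char (intVec k) (intVec m) = 1 := by
    have h : ⟪intVec k, intVec m⟫ = ((∑ i, k i * m i : ℤ) : ℝ) := by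
      simp [PiLp.inner_apply, intVec_apply, mul_comm]
    rw [char, h]
    have := Complex.exp_int_mul_two_pi_mul_I (∑ i, k i * m i)
    rw [← this]
    congr 1
    push_cast
    ring
  rw [this, mul_one]

/-- The action of `ℤⁿ` on `ℝⁿ` by translations. -/
instance latticeAction (n : ℕ) : AddAction (Fin n → ℤ) (E n) where
  vadd k x := x + intVec k
  zero_vadd x := by change x + intVec 0 = x; rw [intVec_zero, add_zero]
  add_vadd k m x := by
    change x + intVec (k + m) = x + intVec m + intVec k
    rw [intVec_add]; abel

lemma vadd_eq_add_intVec (k : Fin n → ℤ) (x : E n) : k +ᵥ x = x + intVec k := rfl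

instance measurableConstVAdd_lattice : MeasurableConstVAdd (Fin n → ℤ) (E n) :=
  ⟨fun k => measurable_id.add_const (intVec k)⟩

instance vaddInvariantMeasure_lattice : VAddInvariantMeasure (Fin n → ℤ) (E n) volume :=
  ⟨fun k _ hs =>
    (measurePreserving_add_right volume (intVec k)).measure_preimage hs.nullMeasurableSet⟩

/-- A property holding almost everywhere holds, for almost every `x`, on the whole orbit
`x + ℤⁿ`. -/
lemma ae_forall_add_intVec {p : E n → Prop} (h : ∀ᵐ x, p x) :
    ∀ᵐ x, ∀ k : Fin n → ℤ, p (x + intVec k) :=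
  ae_all_iff.2 fun k => (measurePreserving_add_right volume (intVec k)).quasiMeasurePreserving.ae h

/-- `D` is a tile: almost every `x` has exactly one `ℤⁿ`-translate in `D`. -/
structure IsTile (D : Set (E n)) : Prop where
  measurableSet : MeasurableSet D
  ae_existsUnique : ∀ᵐ x, ∃! k : Fin n → ℤ, x + intVec k ∈ D

lemma IsTile.isAddFundamentalDomain {D : Set (E n)} (hD : IsTile D) :
    IsAddFundamentalDomain (Fin n → ℤ) D volume where
  nullMeasurableSet := hD.1.nullMeasurableSet
  ae_covers := hD.2.mono fun x hx => hx.exists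
  aedisjoint k m hkm := by
    refine measure_mono_null (t := {x | ¬ ∃! k : Fin n → ℤ, x + intVec k ∈ D}) ?_ (ae_iff.1 hD.2)
    rintro x ⟨hk, hm⟩ hx
    rw [Set.mem_vadd_set_iff_neg_vadd_mem] at hk hm
    exact hkm (neg_injective (hx.unique hk hm))

lemma IsTile.add_right {D : Set (E n)} (hD : IsTile D) (v : E n) : IsTile {x | x - v ∈ D} := by
  refine ⟨hD.1.preimage (by fun_prop), ?_⟩
  filter_upwards [(measurePreserving_sub_right volume v).quasiMeasurePreserving.ae hD.2] with x hx
  simpa only [Set.mem_ofPred_eq, add_sub_right_comm] using hx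

/-- The half-open unit cube. -/
def unitCube (n : ℕ) : Set (E n) := {x | ∀ i, x i ∈ Set.Ico (0 : ℝ) 1}

lemma measurableSet_unitCube : MeasurableSet (unitCube n) := by
  have : unitCube n = ⋂ i, (fun x : E n => x i) ⁻¹' Set.Ico (0 : ℝ) 1 := by
    ext x; simp [unitCube]
  rw [this]
  exact MeasurableSet.iInter fun i => measurableSet_Ico.preimage (by fun_prop)

lemma existsUnique_add_intVec_mem_unitCube (x : E n) :
    ∃! k : Fin n → ℤ, x + intVec k ∈ unitCube n := by
  refine ⟨fun i => -⌊x i⌋, fun i => ?_, fun k hk => funext fun i => ?_⟩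
  · have h1 := Int.floor_le (x i)
    have h2 := Int.lt_floor_add_one (x i)
    simp only [PiLp.add_apply, intVec_apply, Int.cast_neg, Set.mem_Ico]
    constructor <;> linarith
  · have h := hk i
    simp only [PiLp.add_apply, intVec_apply, Set.mem_Ico] at h
    have : ⌊x i⌋ = -k i := by
      rw [Int.floor_eq_iff]
      push_cast
      constructor <;> linarith
    omega

lemma isTile_unitCube : IsTile (unitCube n) :=
  ⟨measurableSet_unitCube, Eventually.of_forall existsUnique_add_intVec_mem_unitCube⟩

lemma volume_unitCube : volume (unitCube n) = 1 := by
  have h : unitCube n = (WithLp.ofLp : E n → Fin n → ℝ) ⁻¹'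
      (Set.univ.pi fun _ => Set.Ico (0 : ℝ) 1) := by
    ext x; simp [unitCube]
  rw [h, (PiLp.volume_preserving_ofLp (Fin n)).measure_preimage
    (MeasurableSet.univ_pi fun _ => measurableSet_Ico).nullMeasurableSet, Real.volume_pi_Ico]
  simp

lemma IsTile.volume_eq {D : Set (E n)} (hD : IsTile D) : volume D = 1 := by
  rw [hD.isAddFundamentalDomain.measure_eq isTile_unitCube.isAddFundamentalDomain, volume_unitCube]

/-- The integral of a nontrivial `ℤⁿ`-periodic character over a tile vanishes: translating the tile
by a vector `v` does not change the integral, but multiplies it by the value of the character at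
`v`, which can be `-1`. -/
lemma IsTile.setIntegral_char_eq_zero {D : Set (E n)} (hD : IsTile D) {k : Fin n → ℤ}
    (hk : k ≠ 0) : ∫ x in D, char (intVec k) x = 0 := by
  set v : E n := (2 * ‖intVec k‖ ^ 2)⁻¹ • intVec k
  have hv : char (intVec k) v = -1 := by
    have hne : ‖intVec k‖ ≠ 0 := by
      rw [norm_ne_zero_iff, ← intVec_zero]
      exact intVec_injective.ne hk
    have h : ⟪intVec k, v⟫ = 1 / 2 := by
      rw [inner_smul_right, real_inner_self_eq_norm_sq]
      field_simp
    rw [char, h, ← Complex.exp_pi_mul_I]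
    congr 2
    push_cast
    ring
  have h1 := hD.isAddFundamentalDomain.setIntegral_eq (hD.add_right v).isAddFundamentalDomain
    (f := char (intVec k)) (fun m x => char_intVec_add_intVec k m x)
  have h2 : ∫ x in {x | x - v ∈ D}, char (intVec k) x = -∫ x in D, char (intVec k) x := by
    rw [← integral_indicator hD.1, ← integral_indicator (hD.add_right v).1,
      ← integral_neg,
      ← integral_add_right_eq_self _ v]
    refine integral_congr_ae (Eventually.of_forall fun x => ?_)
    have hiff : x + v ∈ {x | x - v ∈ D} ↔ x ∈ D := by
      rw [Set.mem_ofPred_eq, add_sub_cancel_right]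
    by_cases hx : x ∈ D
    · simp only [Set.indicator_of_mem hx, Set.indicator_of_mem (hiff.2 hx), char_add_right, hv]
      ring
    · simp only [Set.indicator_of_notMem hx, Set.indicator_of_notMem (fun h => hx (hiff.1 h)),
        neg_zero]
  rw [h2] at h1
  linear_combination h1 / 2

/-! ### Cutting off to a measurable set -/

/-- Multiplication of `g ∈ L²(ℝⁿ)` by the indicator function of `A`. -/
def cutoff (A : Set (E n)) (hA : MeasurableSet A) (g : L2 n) : L2 n :=
  ((Lp.memLp g).indicator hA).toLp _

lemma coeFn_cutoff (A : Set (E n)) (hA : MeasurableSet A) (g : L2 n) :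
    cutoff A hA g =ᵐ[volume] A.indicator g :=
  ((Lp.memLp g).indicator hA).coeFn_toLp

/-- Multiplication of `g ∈ L²(ℝⁿ)` by the trigonometric polynomial `∑ c_k exp (2 π i k·x)`. -/
def trigMul (c : (Fin n → ℤ) →₀ ℂ) (g : L2 n) : L2 n :=
  c.sum fun k a => a • modulation (intVec k) g

lemma coeFn_finset_sum {ι : Type*} (s : Finset ι) (f : ι → L2 n) :
    (∑ i ∈ s, f i : L2 n) =ᵐ[volume] fun x => ∑ i ∈ s, f i x := by
  classical
  induction s using Finset.induction_on with
  | empty => exact Lp.coeFn_zero ℂ 2 (volume : Measure (E n))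
  | insert i s hi ih =>
    rw [Finset.sum_insert hi]
    filter_upwards [Lp.coeFn_add (f i) (∑ i ∈ s, f i), ih] with x h1 h2
    rw [h1, Pi.add_apply, h2, Finset.sum_insert hi]

lemma coeFn_trigMul (c : (Fin n → ℤ) →₀ ℂ) (g : L2 n) :
    trigMul c g =ᵐ[volume] fun x => (c.sum fun k a => a * char (intVec k) x) * g x := by
  have h1 : ∀ᵐ x, ∀ k : Fin n → ℤ, (c k • modulation (intVec k) g : L2 n) x =
      c k * (char (intVec k) x * g x) := ae_all_iff.2 fun k => by
    filter_upwards [Lp.coeFn_smul (c k) (modulation (intVec k) g),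
      coeFn_modulation (intVec k) g] with x h1 h2
    rw [h1, Pi.smul_apply, h2, smul_eq_mul]
  filter_upwards [coeFn_finset_sum c.support fun k => c k • modulation (intVec k) g, h1] with x h2 h3
  simp only [trigMul, Finsupp.sum, Finset.sum_mul] at h2 ⊢
  rw [h2]
  exact Finset.sum_congr rfl fun k _ => by rw [h3, mul_assoc]

/-! ### Density of trigonometric polynomials -/

/-- The projection `ℝⁿ → ℝⁿ / ℤⁿ`. -/
def toTorus (x : E n) : UnitAddTorus (Fin n) := fun i => (x i : UnitAddCircle)

lemma measurable_toTorus : Measurable (toTorus : E n → UnitAddTorus (Fin n)) :=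
  measurable_pi_lambda _ fun i => AddCircle.measurable_mk'.comp (by fun_prop)

lemma mFourier_toTorus (k : Fin n → ℤ) (x : E n) :
    UnitAddTorus.mFourier k (toTorus x) = char (intVec k) x := by
  simp only [UnitAddTorus.mFourier, toTorus, ContinuousMap.coe_mk, fourier_coe_apply,
    ← Complex.exp_sum, char, PiLp.inner_apply, intVec_apply]
  congr 1
  push_cast
  rw [Finset.mul_sum, Finset.sum_mul]
  refine Finset.sum_congr rfl fun i _ => ?_
  simp
  ring

/-- A measurable section of the projection `ℝⁿ → ℝⁿ / ℤⁿ`. -/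
def torusSection (t : UnitAddTorus (Fin n)) : E n :=
  WithLp.toLp 2 (UnitAddTorus.measurableEquivPiIoc (0 : Fin n → ℝ) t).1

lemma measurable_torusSection :
    Measurable (torusSection : UnitAddTorus (Fin n) → E n) :=
  (WithLp.measurable_toLp 2 _).comp
    (measurable_subtype_coe.comp (UnitAddTorus.measurableEquivPiIoc 0).measurable)

lemma exists_torusSection_toTorus (x : E n) :
    ∃ k : Fin n → ℤ, torusSection (toTorus x) = x + intVec k := by
  have h : ∀ i, ∃ m : ℤ, torusSection (toTorus x) i = x i + m := by
    intro i
    have h1 : ((torusSection (toTorus x) i : ℝ) : UnitAddCircle) = (x i : ℝ) :=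
      (AddCircle.equivIoc 1 ((0 : Fin n → ℝ) i)).symm_apply_apply (x i : UnitAddCircle)
    rw [← sub_eq_zero, ← AddCircle.coe_sub, AddCircle.coe_eq_zero_iff] at h1
    obtain ⟨m, hm⟩ := h1
    refine ⟨m, ?_⟩
    simp only [zsmul_eq_mul, mul_one] at hm
    linarith
  choose k hk using h
  exact ⟨k, by ext i; exact hk i⟩

/-- The norm of `F · g` in `L²(ℝⁿ)`, for `F` a `ℤⁿ`-periodic function, is controlled by the norm of
`F` in a weighted `L²` space of the torus. -/
lemma eLpNorm_comp_toTorus_mul_le {w : E n → ℝ≥0∞} (hw : AEMeasurable w) {g : L2 n}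
    (hg : ∀ x, ‖g x‖ₑ ^ 2 ≤ w x) {F : UnitAddTorus (Fin n) → ℂ} (hF : Measurable F) :
    eLpNorm (fun x => F (toTorus x) * g x) 2 volume ≤
      eLpNorm F 2 ((volume.withDensity w).map toTorus) := by
  rw [eLpNorm_eq_lintegral_rpow_enorm_toReal two_ne_zero ENNReal.ofNat_ne_top,
    eLpNorm_eq_lintegral_rpow_enorm_toReal two_ne_zero ENNReal.ofNat_ne_top]
  gcongr ?_ ^ _
  simp only [ENNReal.toReal_ofNat, ENNReal.rpow_ofNat]
  rw [lintegral_map (by fun_prop) measurable_toTorus, lintegral_withDensity_eq_lintegral_mul₀ hw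
    (g := fun x => ‖F (toTorus x)‖ₑ ^ 2)
    (((hF.comp measurable_toTorus).enorm.pow_const 2).aemeasurable)]
  refine lintegral_mono fun x => ?_
  simp only [enorm_mul, mul_pow, Pi.mul_apply]
  rw [mul_comm]
  exact mul_le_mul_left (hg x) _

/-- Multiplication by the indicator function of a `ℤⁿ`-periodic set is, on any pair of `L²`
functions, a limit of multiplications by trigonometric polynomials. -/
lemma cutoff_mem_closure_trigMul {A : Set (E n)} (hA : MeasurableSet A)
    (hper : ∀ (k : Fin n → ℤ) x, x + intVec k ∈ A ↔ x ∈ A) (g₁ g₂ : L2 n) :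
    (cutoff A hA g₁, cutoff A hA g₂) ∈
      closure (Set.range fun c : (Fin n → ℤ) →₀ ℂ => (trigMul c g₁, trigMul c g₂)) := by
  set w : E n → ℝ≥0∞ := fun x => ‖g₁ x‖ₑ ^ 2 + ‖g₂ x‖ₑ ^ 2
  have hw : AEMeasurable w := by
    have h1 := (Lp.stronglyMeasurable g₁).measurable
    have h2 := (Lp.stronglyMeasurable g₂).measurable
    exact ((h1.enorm.pow_const 2).add (h2.enorm.pow_const 2)).aemeasurable
  set ν : Measure (UnitAddTorus (Fin n)) := (volume.withDensity w).map toTorus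
  have hfin : ∀ g : L2 n, ∫⁻ x, ‖g x‖ₑ ^ 2 ≠ ∞ := by
    intro g
    have := (Lp.memLp g).2
    have h := lintegral_rpow_enorm_lt_top_of_eLpNorm_lt_top two_ne_zero ENNReal.ofNat_ne_top this
    simpa using h.ne
  have : IsFiniteMeasure ν := by
    have : IsFiniteMeasure ((volume : Measure (E n)).withDensity w) := by
      refine isFiniteMeasure_withDensity ?_
      rw [lintegral_add_left' ((Lp.stronglyMeasurable g₁).measurable.enorm.pow_const 2).aemeasurable]
      exact ENNReal.add_ne_top.2 ⟨hfin g₁, hfin g₂⟩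
    exact Measure.isFiniteMeasure_map _ _
  set F : UnitAddTorus (Fin n) → ℂ := (torusSection ⁻¹' A).indicator 1
  have hB : MeasurableSet (torusSection ⁻¹' A : Set (UnitAddTorus (Fin n))) :=
    hA.preimage measurable_torusSection
  have hF : Measurable F := measurable_one.indicator hB
  have hFA : ∀ (x : E n) (g : E n → ℂ), A.indicator g x = F (toTorus x) * g x := by
    intro x g
    obtain ⟨k, hk⟩ := exists_torusSection_toTorus x
    have hiff : toTorus x ∈ torusSection ⁻¹' A ↔ x ∈ A := by
      rw [Set.mem_preimage, hk, hper]
    by_cases hx : x ∈ A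
    · simp [F, Set.indicator_of_mem hx, Set.indicator_of_mem (hiff.2 hx)]
    · simp [F, Set.indicator_of_notMem hx, Set.indicator_of_notMem (fun h => hx (hiff.1 h))]
  have hFL : MemLp F 2 ν := (memLp_const (1 : ℂ)).indicator hB
  have hdense : (Submodule.map (ContinuousMap.toLp (E := ℂ) 2 ν ℂ).toLinearMap
      (Submodule.span ℂ (Set.range (UnitAddTorus.mFourier (d := Fin n))))).topologicalClosure = ⊤ :=
    (ContinuousMap.toLp_denseRange ℂ ν ℂ (p := 2) ENNReal.ofNat_ne_top).topologicalClosure_map_submodule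
      UnitAddTorus.span_mFourier_closure_eq_top
  refine Metric.mem_closure_iff.2 fun ε hε => ?_
  have hmem : hFL.toLp F ∈ closure ((Submodule.map (ContinuousMap.toLp (E := ℂ) 2 ν ℂ).toLinearMap
      (Submodule.span ℂ (Set.range (UnitAddTorus.mFourier (d := Fin n))))) : Set (Lp ℂ 2 ν)) := by
    rw [← Submodule.topologicalClosure_coe, hdense]
    trivial
  obtain ⟨_, ⟨P, hP, rfl⟩, hdist⟩ := Metric.mem_closure_iff.1 hmem ε hε
  obtain ⟨c, rfl⟩ := (Finsupp.mem_span_range_iff_exists_finsupp).1 hP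
  refine ⟨_, ⟨c, rfl⟩, ?_⟩
  set P : C(UnitAddTorus (Fin n), ℂ) := c.sum fun k a => a • UnitAddTorus.mFourier k
  have hPc : ∀ x : E n, P (toTorus x) = c.sum fun k a => a * char (intVec k) x := by
    intro x
    simp only [P, Finsupp.sum, ContinuousMap.coe_sum, Finset.sum_apply, ContinuousMap.coe_smul,
      Pi.smul_apply, mFourier_toTorus, smul_eq_mul]
  have hd : eLpNorm (fun t => F t - P t) 2 ν < ENNReal.ofReal ε := by
    rw [dist_edist, Lp.edist_def] at hdist
    have h1 : eLpNorm (fun t => F t - P t) 2 ν =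
        eLpNorm (⇑(hFL.toLp F) - ⇑(ContinuousMap.toLp (E := ℂ) 2 ν ℂ P)) 2 ν := by
      refine eLpNorm_congr_ae ?_
      filter_upwards [hFL.coeFn_toLp, ContinuousMap.coeFn_toLp (𝕜 := ℂ) (E := ℂ) (p := (2 : ℝ≥0∞)) ν P] with t h1 h2
      rw [Pi.sub_apply, h1, h2]
    rw [h1]
    refine (ENNReal.lt_ofReal_iff_toReal_lt ?_).2 hdist
    exact (((Lp.memLp _).sub (Lp.memLp _)).2).ne
  have key : ∀ g : L2 n, (∀ x, ‖g x‖ₑ ^ 2 ≤ w x) → dist (cutoff A hA g) (trigMul c g) < ε := by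
    intro g hg
    rw [dist_edist, Lp.edist_def]
    have h1 : eLpNorm (⇑(cutoff A hA g) - ⇑(trigMul c g)) 2 volume =
        eLpNorm (fun x => (fun t => F t - P t) (toTorus x) * g x) 2 volume := by
      refine eLpNorm_congr_ae ?_
      filter_upwards [coeFn_cutoff A hA g, coeFn_trigMul c g] with x h1 h2
      rw [Pi.sub_apply, h1, h2, hFA, ← hPc, sub_mul]
    rw [h1]
    have h2 := (eLpNorm_comp_toTorus_mul_le hw hg (F := fun t => F t - P t)
      (hF.sub P.continuous.measurable)).trans_lt hd
    exact (ENNReal.lt_ofReal_iff_toReal_lt h2.ne_top).1 h2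
  rw [Prod.dist_eq]
  exact max_lt (key g₁ fun x => le_self_add) (key g₂ fun x => le_add_self)

/-! ### Indicator functions and orthonormality on tiles -/

/-- The indicator function of a set of finite measure, as an element of `L²(ℝⁿ)`. -/
def indicatorL2 (D : Set (E n)) (hD : MeasurableSet D) (h : volume D ≠ ∞) : L2 n :=
  indicatorConstLp 2 hD h 1

lemma coeFn_indicatorL2 (D : Set (E n)) (hD : MeasurableSet D) (h : volume D ≠ ∞) :
    indicatorL2 D hD h =ᵐ[volume] D.indicator fun _ => (1 : ℂ) :=
  indicatorConstLp_coeFn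

lemma IsTile.volume_ne_top {D : Set (E n)} (hD : IsTile D) : volume D ≠ ∞ := by
  rw [hD.volume_eq]
  exact ENNReal.one_ne_top

lemma _root_.Orthonormal.norm_sq_finsupp_sum {ι H : Type*} [NormedAddCommGroup H]
    [InnerProductSpace ℂ H] {v : ι → H} (hv : Orthonormal ℂ v) (c : ι →₀ ℂ) :
    ‖c.sum fun i a => a • v i‖ ^ 2 = c.sum fun _ a => ‖a‖ ^ 2 := by
  have h := hv.inner_finsupp_eq_sum_left c c
  rw [Finsupp.linearCombination_apply, inner_self_eq_norm_sq_to_K] at h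
  have h2 : ((‖c.sum fun i a => a • v i‖ ^ 2 : ℝ) : ℂ) =
      ((c.sum fun _ a => ‖a‖ ^ 2 : ℝ) : ℂ) := by
    push_cast
    refine h.trans ?_
    simp only [Finsupp.sum, Complex.ofReal_sum]
    refine Finset.sum_congr rfl fun i _ => ?_
    rw [mul_comm, Complex.mul_conj, Complex.normSq_eq_norm_sq]
  exact_mod_cast h2

/-- For a tile `D`, the integer modulations of `χ_D` are orthonormal. -/
lemma IsTile.orthonormal {D : Set (E n)} (hD : IsTile D) :
    Orthonormal ℂ fun k : Fin n → ℤ =>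
      modulation (intVec k) (indicatorL2 D hD.1 hD.volume_ne_top) := by
  refine ⟨fun k => ?_, fun k m hkm => ?_⟩
  · rw [LinearIsometry.norm_map, indicatorL2, norm_indicatorConstLp two_ne_zero
      ENNReal.ofNat_ne_top, measureReal_def, hD.volume_eq]
    simp
  · change inner ℂ (modulation (intVec k) (indicatorL2 D hD.1 hD.volume_ne_top))
      (modulation (intVec m) (indicatorL2 D hD.1 hD.volume_ne_top)) = 0
    rw [L2.inner_def, ← hD.setIntegral_char_eq_zero (k := m - k) (sub_ne_zero.2 hkm.symm),
      ← integral_indicator hD.1]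
    refine integral_congr_ae ?_
    filter_upwards [coeFn_indicatorL2 D hD.1 hD.volume_ne_top,
      coeFn_modulation (intVec k) (indicatorL2 D hD.1 hD.volume_ne_top),
      coeFn_modulation (intVec m) (indicatorL2 D hD.1 hD.volume_ne_top)] with x h1 h2 h3
    rw [h2, h3, h1]
    by_cases hx : x ∈ D
    · simp only [Set.indicator_of_mem hx, mul_one, RCLike.inner_apply]
      rw [sub_eq_add_neg, intVec_add, intVec_neg, char_add_left, char_neg]
    · simp [Set.indicator_of_notMem hx]

lemma ofReal_norm_sq_eq_lintegral (f : L2 n) :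
    ENNReal.ofReal (‖f‖ ^ 2) = ∫⁻ x, ‖f x‖ₑ ^ 2 := by
  have h := lintegral_rpow_enorm_eq_rpow_eLpNorm' (μ := volume) (f := f) (q := 2) two_pos
  have h2 : eLpNorm f 2 volume = eLpNorm' f 2 volume := by
    rw [eLpNorm_eq_eLpNorm' two_ne_zero ENNReal.ofNat_ne_top]
    rfl
  simp only [ENNReal.rpow_ofNat] at h
  rw [h, ← h2, ENNReal.ofReal_pow (norm_nonneg _), Lp.norm_def,
    ENNReal.ofReal_toReal (Lp.memLp f).2.ne]

/-! ### Fibres, and the upper bound for the multiplicity -/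

/-- The fibre of `f` at `x`: the restriction of `f` to the orbit `x + ℤⁿ`. -/
def fiber (f : E n → ℂ) (x : E n) : (Fin n → ℤ) → ℂ := fun k => f (x + intVec k)

/-- Almost everywhere, the fibre of a function in the closed span of the integer modulations of
`g₁, …, g_ℓ` is a linear combination of the fibres of `g₁, …, g_ℓ`. -/
lemma ae_fiber_mem_span {ι : Type*} [Finite ι] {g : ι → L2 n} {f : L2 n}
    (hf : f ∈ (Submodule.span ℂ (Set.range fun p : (Fin n → ℤ) × ι =>
      modulation (intVec p.1) (g p.2))).topologicalClosure) :
    ∀ᵐ x, fiber f x ∈ Submodule.span ℂ (Set.range fun j => fiber (g j) x) := by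
  have hspan : ∀ u ∈ Submodule.span ℂ (Set.range fun p : (Fin n → ℤ) × ι =>
      modulation (intVec p.1) (g p.2)),
      ∀ᵐ x, fiber u x ∈ Submodule.span ℂ (Set.range fun j => fiber (g j) x) := by
    intro u hu
    induction hu using Submodule.span_induction with
    | mem u hu =>
      obtain ⟨⟨m, j⟩, rfl⟩ := hu
      filter_upwards [ae_forall_add_intVec (coeFn_modulation (intVec m) (g j))] with x hx
      have : fiber (modulation (intVec m) (g j)) x = char (intVec m) x • fiber (g j) x := by
        funext k
        simp only [fiber, hx k, char_intVec_add_intVec, Pi.smul_apply, smul_eq_mul]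
      change fiber (modulation (intVec m) (g j)) x ∈ _
      rw [this]
      exact Submodule.smul_mem _ _ (Submodule.subset_span ⟨j, rfl⟩)
    | zero =>
      filter_upwards [ae_forall_add_intVec (Lp.coeFn_zero ℂ 2 (volume : Measure (E n)))] with x hx
      have : fiber (0 : L2 n) x = 0 := funext fun k => hx k
      rw [this]
      exact zero_mem _
    | add u v _ _ hu hv =>
      filter_upwards [ae_forall_add_intVec (Lp.coeFn_add u v), hu, hv] with x hx h1 h2
      have : fiber (u + v : L2 n) x = fiber u x + fiber v x := funext fun k => hx k
      rw [this]
      exact add_mem h1 h2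
    | smul c u _ hu =>
      filter_upwards [ae_forall_add_intVec (Lp.coeFn_smul c u), hu] with x hx h1
      have : fiber (c • u : L2 n) x = c • fiber u x := funext fun k => hx k
      rw [this]
      exact Submodule.smul_mem _ _ h1
  obtain ⟨u, hu, hlim⟩ := exists_seq_tendsto_ae_of_mem_closure hf
  filter_upwards [ae_all_iff.2 fun m => hspan (u m) (hu m), ae_forall_add_intVec hlim] with x h1 h2
  have : FiniteDimensional ℂ (Submodule.span ℂ (Set.range fun j => fiber (g j) x)) :=
    FiniteDimensional.span_of_finite ℂ (Set.finite_range _)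
  exact (Submodule.closed_of_finiteDimensional
    (Submodule.span ℂ (Set.range fun j => fiber (g j) x))).mem_of_tendsto
    (tendsto_pi_nhds.2 h2) (Eventually.of_forall h1)

/-- If `L²(Ω)` is spanned by the integer modulations of `ℓ` functions, then almost every orbit
meets `Ω` in at most `ℓ` points: the fibres contain the unit vectors at all points of the orbit
in `Ω`, but lie in a space of dimension at most `ℓ`. -/
lemma ae_encard_le {ℓ : ℕ} {g : Fin ℓ → L2 n} {Ω : Set (E n)} (hΩ : MeasurableSet Ω)
    (h : supportedOn Ω ≤ (Submodule.span ℂ (Set.range fun p : (Fin n → ℤ) × Fin ℓ =>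
      modulation (intVec p.1) (g p.2))).topologicalClosure) :
    ∀ᵐ x, {k : Fin n → ℤ | x + intVec k ∈ Ω}.encard ≤ ℓ := by
  classical
  have hS : ∀ m : Fin n → ℤ, MeasurableSet (Ω ∩ {x | x - intVec m ∈ unitCube n}) := fun m =>
    hΩ.inter (isTile_unitCube.add_right _).1
  have hv : ∀ m : Fin n → ℤ, volume (Ω ∩ {x | x - intVec m ∈ unitCube n}) ≠ ∞ := fun m =>
    ne_top_of_le_ne_top (isTile_unitCube.add_right (intVec m)).volume_ne_top
      (measure_mono Set.inter_subset_right)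
  set u : (Fin n → ℤ) → L2 n := fun m => indicatorL2 _ (hS m) (hv m)
  have hu : ∀ m, u m ∈ supportedOn Ω := by
    intro m
    refine mem_supportedOn.2 ?_
    filter_upwards [coeFn_indicatorL2 _ (hS m) (hv m)] with x hx hxΩ
    rw [hx, Set.indicator_of_notMem fun h => hxΩ h.1]
  filter_upwards [ae_all_iff.2 fun m => ae_fiber_mem_span (h (hu m)),
    ae_all_iff.2 fun m => ae_forall_add_intVec (coeFn_indicatorL2 _ (hS m) (hv m))] with x h1 h2
  set S := Submodule.span ℂ (Set.range fun j => fiber (g j) x)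
  have : FiniteDimensional ℂ S := FiniteDimensional.span_of_finite ℂ (Set.finite_range _)
  have hsingle : ∀ k, x + intVec k ∈ Ω → (Pi.single k 1 : (Fin n → ℤ) → ℂ) ∈ S := by
    intro k hk
    obtain ⟨m, hm, hmu⟩ := existsUnique_add_intVec_mem_unitCube (x + intVec k)
    have : fiber (u (-m)) x = Pi.single k 1 := by
      funext k'
      rw [fiber, h2 (-m) k']
      by_cases hkk : k' = k
      · subst hkk
        rw [Pi.single_eq_same, Set.indicator_of_mem]
        refine ⟨hk, ?_⟩
        rwa [Set.mem_ofPred_eq, intVec_neg, sub_neg_eq_add]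
      · rw [Pi.single_eq_of_ne hkk, Set.indicator_of_notMem]
        rintro ⟨-, h3⟩
        rw [Set.mem_ofPred_eq, intVec_neg, sub_neg_eq_add] at h3
        have := hmu (k' - k + m) (by
          have e : x + intVec k + intVec (k' - k + m) = x + intVec k' + intVec m := by
            rw [add_assoc, add_assoc, ← intVec_add, ← intVec_add]
            congr 2
            abel
          change x + intVec k + intVec (k' - k + m) ∈ unitCube n
          rwa [e])
        exact hkk (sub_eq_zero.1 (by simpa using this))
    exact this ▸ h1 (-m)
  have hli : LinearIndependent ℂ fun k : {k : Fin n → ℤ | x + intVec k ∈ Ω} =>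
      (⟨Pi.single k.1 1, hsingle k.1 k.2⟩ : S) := by
    refine LinearIndependent.of_comp S.subtype ?_
    exact (Pi.linearIndependent_single_one (Fin n → ℤ) ℂ).comp _ Subtype.val_injective
  have hfin : Finite {k : Fin n → ℤ | x + intVec k ∈ Ω} := hli.finite
  have := Fintype.ofFinite {k : Fin n → ℤ | x + intVec k ∈ Ω}
  have hcard := hli.fintype_card_le_finrank.trans (finrank_range_le_card (R := ℂ) _)
  rw [Fintype.card_fin] at hcard
  rw [Set.encard_eq_coe_toFinset_card, Set.toFinset_card]
  exact_mod_cast hcard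

/-! ### The lower bound for the multiplicity -/

/-- The square norm of the fibre of `g` at `x`. -/
def fiberNormSq (g : E n → ℂ) (x : E n) : ℝ≥0∞ := ∑' k : Fin n → ℤ, ‖g (x + intVec k)‖ₑ ^ 2

lemma measurable_fiberNormSq {g : E n → ℂ} (hg : Measurable g) : Measurable (fiberNormSq g) :=
  Measurable.tsum fun k =>
    (hg.comp (measurable_id.add_const (intVec k))).enorm.pow_const 2

lemma fiberNormSq_add_intVec (g : E n → ℂ) (k : Fin n → ℤ) (x : E n) :
    fiberNormSq g (x + intVec k) = fiberNormSq g x := by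
  rw [fiberNormSq, fiberNormSq, ← (Equiv.addLeft k).tsum_eq fun m => ‖g (x + intVec m)‖ₑ ^ 2]
  refine tsum_congr fun m => ?_
  rw [add_assoc, ← intVec_add]
  rfl

lemma mul_norm_sq_le_of_mem_closure {H : Type*} [NormedAddCommGroup H] {S : Set (H × H)} {K : ℝ}
    (h : ∀ p ∈ S, K * ‖p.1‖ ^ 2 ≤ ‖p.2‖ ^ 2) {p : H × H} (hp : p ∈ closure S) :
    K * ‖p.1‖ ^ 2 ≤ ‖p.2‖ ^ 2 := by
  have hcl : IsClosed {p : H × H | K * ‖p.1‖ ^ 2 ≤ ‖p.2‖ ^ 2} :=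
    isClosed_le (by fun_prop) (by fun_prop)
  exact closure_minimal h hcl hp

/-- If multiplication of `g` by trigonometric polynomials is bounded below, then so are the norms
of the fibres of `g`. -/
lemma ae_le_fiberNormSq {g : L2 n} {K : ℝ} (hK : 0 ≤ K)
    (h : ∀ a : (Fin n → ℤ) →₀ ℂ, K * (a.sum fun _ z => ‖z‖ ^ 2) ≤ ‖trigMul a g‖ ^ 2) :
    ∀ᵐ x, ENNReal.ofReal K ≤ fiberNormSq g x := by
  have hgm : Measurable g := (Lp.stronglyMeasurable g).measurable
  have hQ := isTile_unitCube (n := n)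
  have hFD := hQ.isAddFundamentalDomain
  set q : L2 n := indicatorL2 (unitCube n) hQ.1 hQ.volume_ne_top
  set A : Set (E n) := {x | fiberNormSq g x < ENNReal.ofReal K}
  have hA : MeasurableSet A := measurableSet_lt (measurable_fiberNormSq hgm) measurable_const
  have hper : ∀ (k : Fin n → ℤ) x, x + intVec k ∈ A ↔ x ∈ A := by
    intro k x
    simp only [A, Set.mem_ofPred_eq, fiberNormSq_add_intVec]
  -- the inequality passes from trigonometric polynomials to the indicator function of `A`
  have h1 : K * ‖cutoff A hA q‖ ^ 2 ≤ ‖cutoff A hA g‖ ^ 2 := by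
    refine mul_norm_sq_le_of_mem_closure ?_ (cutoff_mem_closure_trigMul hA hper q g)
    rintro _ ⟨a, rfl⟩
    have : ‖trigMul a q‖ ^ 2 = a.sum fun _ z => ‖z‖ ^ 2 := hQ.orthonormal.norm_sq_finsupp_sum a
    change K * ‖trigMul a q‖ ^ 2 ≤ ‖trigMul a g‖ ^ 2
    rw [this]
    exact h a
  have h2 : ENNReal.ofReal K * volume (A ∩ unitCube n) ≤ ∫⁻ x in A ∩ unitCube n, fiberNormSq g x := by
    have e1 : ENNReal.ofReal (‖cutoff A hA q‖ ^ 2) = volume (A ∩ unitCube n) := by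
      rw [ofReal_norm_sq_eq_lintegral, ← lintegral_indicator_one (hA.inter hQ.1)]
      refine lintegral_congr_ae ?_
      filter_upwards [coeFn_cutoff A hA q,
        coeFn_indicatorL2 (unitCube n) hQ.1 hQ.volume_ne_top] with x h1 h2
      rw [h1]
      by_cases hxA : x ∈ A <;> by_cases hxQ : x ∈ unitCube n <;>
        simp [Set.indicator, q, h2, hxA, hxQ]
    have e2 : ENNReal.ofReal (‖cutoff A hA g‖ ^ 2) = ∫⁻ x in A ∩ unitCube n, fiberNormSq g x := by
      have hm : Measurable (A.indicator fun x => ‖g x‖ₑ ^ 2) :=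
        (hgm.enorm.pow_const 2).indicator hA
      have e : ∫⁻ x, ‖cutoff A hA g x‖ₑ ^ 2 = ∫⁻ x, A.indicator (fun x => ‖g x‖ₑ ^ 2) x := by
        refine lintegral_congr_ae ?_
        filter_upwards [coeFn_cutoff A hA g] with x hx
        rw [hx]
        by_cases hxA : x ∈ A <;> simp [hxA]
      rw [ofReal_norm_sq_eq_lintegral, e, hFD.lintegral_eq_tsum'', ← lintegral_tsum,
        ← setLIntegral_indicator hA]
      · refine lintegral_congr fun x => ?_
        by_cases hxA : x ∈ A
        · rw [Set.indicator_of_mem hxA]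
          refine tsum_congr fun k => ?_
          rw [vadd_eq_add_intVec, Set.indicator_of_mem ((hper k x).2 hxA)]
        · rw [Set.indicator_of_notMem hxA, ENNReal.tsum_eq_zero]
          intro k
          rw [vadd_eq_add_intVec, Set.indicator_of_notMem fun h => hxA ((hper k x).1 h)]
      · exact fun k => (hm.comp (measurable_id.add_const (intVec k))).aemeasurable
    rw [← e1, ← e2, ← ENNReal.ofReal_mul hK]
    exact ENNReal.ofReal_le_ofReal h1
  have h3 : volume (A ∩ unitCube n) = 0 := by
    by_contra hne
    refine absurd h2 (not_le.2 ?_)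
    rw [← setLIntegral_const]
    refine setLIntegral_strict_mono (hA.inter hQ.1) hne measurable_const ?_ ?_
    · refine ne_top_of_le_ne_top (b := ENNReal.ofReal K * volume (unitCube n)) ?_ ?_
      · rw [volume_unitCube, mul_one]
        exact ENNReal.ofReal_ne_top
      · refine (setLIntegral_mono' (hA.inter hQ.1) fun x hx => hx.1.le).trans ?_
        rw [setLIntegral_const]
        gcongr
        exact Set.inter_subset_right
    · exact Eventually.of_forall fun x hx => hx.1
  have h4 : volume A = 0 := by
    refine hFD.measure_zero_of_invariant A (fun k => ?_) h3
    ext x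
    rw [Set.mem_vadd_set_iff_neg_vadd_mem]
    exact hper (-k) x
  filter_upwards [measure_eq_zero_iff_ae_notMem.1 h4] with x hx
  exact not_lt.1 hx

/-- If the integer modulations of `g₁, …, g_ℓ` satisfy a lower Riesz bound and `g₁, …, g_ℓ` are
supported on a set `Ω` meeting almost every orbit in at most `ℓ` points, then `Ω` meets almost
every orbit in at least `ℓ` points: the fibres of `g₁, …, g_ℓ` are linearly independent and
supported on the points of the orbit in `Ω`. -/
lemma ae_le_encard {ℓ : ℕ} {g : Fin ℓ → L2 n} {Ω : Set (E n)} (hg : ∀ j, g j ∈ supportedOn Ω)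
    {C : ℝ} (hC : 0 < C)
    (h : ∀ c : ((Fin n → ℤ) × Fin ℓ) →₀ ℂ, C * (c.sum fun _ a => ‖a‖ ^ 2) ≤
      ‖c.sum fun p a => a • modulation (intVec p.1) (g p.2)‖ ^ 2)
    (hfin : ∀ᵐ x, {k : Fin n → ℤ | x + intVec k ∈ Ω}.encard ≤ ℓ) :
    ∀ᵐ x, ℓ ≤ {k : Fin n → ℤ | x + intVec k ∈ Ω}.encard := by
  classical
  have h1 : ∀ b : Fin ℓ → ℂ, ∀ᵐ x, ENNReal.ofReal (C * ∑ j, ‖b j‖ ^ 2) ≤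
      ∑' k : Fin n → ℤ, ‖∑ j, b j * g j (x + intVec k)‖ₑ ^ 2 := by
    intro b
    have h2 := ae_le_fiberNormSq (g := ∑ j, b j • g j) (K := C * ∑ j, ‖b j‖ ^ 2)
      (by positivity) (by
        intro a
        set d : ((Fin n → ℤ) × Fin ℓ) →₀ ℂ := Finsupp.onFinset (a.support ×ˢ Finset.univ)
          (fun p => a p.1 * b p.2) (fun p hp => by
            simp only [Finset.mem_product, Finsupp.mem_support_iff, Finset.mem_univ, and_true]
            exact left_ne_zero_of_mul hp)
        have hd := h d
        have e1 : (d.sum fun _ z => ‖z‖ ^ 2) =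
            (∑ j, ‖b j‖ ^ 2) * (a.sum fun _ z => ‖z‖ ^ 2) := by
          rw [Finsupp.onFinset_sum _ (by simp), Finset.sum_product, Finsupp.sum, mul_comm,
            Finset.sum_mul]
          simp only [norm_mul, mul_pow, Finset.mul_sum]
        have e2 : (d.sum fun p z => z • modulation (intVec p.1) (g p.2)) =
            trigMul a (∑ j, b j • g j) := by
          rw [Finsupp.onFinset_sum _ (by simp), Finset.sum_product, trigMul, Finsupp.sum]
          simp only [map_sum, map_smul, Finset.smul_sum, mul_smul]
        rwa [e1, e2, ← mul_assoc] at hd)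
    filter_upwards [h2, ae_forall_add_intVec (coeFn_finset_sum Finset.univ fun j => b j • g j),
      ae_all_iff.2 fun j => ae_forall_add_intVec (Lp.coeFn_smul (b j) (g j))] with x h3 h4 h5
    refine h3.trans (le_of_eq (tsum_congr fun k => ?_))
    rw [h4 k]
    simp only [h5 _ k, Pi.smul_apply, smul_eq_mul]
  filter_upwards [hfin, ae_all_iff.2 fun m => h1 (TopologicalSpace.denseSeq (Fin ℓ → ℂ) m),
    ae_all_iff.2 fun j => ae_forall_add_intVec (hg j)] with x h2 h3 h4
  have hF : {k : Fin n → ℤ | x + intVec k ∈ Ω}.Finite :=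
    Set.finite_of_encard_le_coe h2
  set F := hF.toFinset
  have hFm : ∀ k, k ∉ F → x + intVec k ∉ Ω := fun k hk hΩ => hk (hF.mem_toFinset.2 hΩ)
  -- since the fibres are finitely supported, the lower bound extends to all coefficients
  have h5 : ∀ b : Fin ℓ → ℂ, C * ∑ j, ‖b j‖ ^ 2 ≤
      ∑ k ∈ F, ‖∑ j, b j * g j (x + intVec k)‖ ^ 2 := by
    intro b
    refine (TopologicalSpace.denseRange_denseSeq (Fin ℓ → ℂ)).induction_on b
      (isClosed_le (by fun_prop) (by fun_prop)) fun m => ?_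
    have h6 := h3 m
    rw [tsum_eq_sum (s := F) fun k hk => by simp [h4 _ k (hFm k hk)]] at h6
    have e : ∀ k, ‖∑ j, TopologicalSpace.denseSeq (Fin ℓ → ℂ) m j * g j (x + intVec k)‖ₑ ^ 2 =
        ENNReal.ofReal
          (‖∑ j, TopologicalSpace.denseSeq (Fin ℓ → ℂ) m j * g j (x + intVec k)‖ ^ 2) :=
      fun k => by rw [ENNReal.ofReal_pow (norm_nonneg _), ofReal_norm]
    simp only [e] at h6
    rw [← ENNReal.ofReal_sum_of_nonneg fun k _ => sq_nonneg _] at h6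
    exact (ENNReal.ofReal_le_ofReal_iff (Finset.sum_nonneg fun k _ => sq_nonneg _)).1 h6
  set T : (Fin ℓ → ℂ) →ₗ[ℂ] (F → ℂ) :=
    Matrix.mulVecLin (Matrix.of fun (k : F) j => g j (x + intVec k))
  have hT : Function.Injective T := by
    refine (injective_iff_map_eq_zero T).2 fun b hb => ?_
    have h6 : ∀ k ∈ F, ∑ j, b j * g j (x + intVec k) = 0 := by
      intro k hk
      have := congrFun hb ⟨k, hk⟩
      simpa [T, Matrix.mulVec, dotProduct, mul_comm] using this
    have h7 := h5 b
    rw [Finset.sum_eq_zero (s := F) fun k hk => by rw [h6 k hk]; simp] at h7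
    have h8 : ∑ j, ‖b j‖ ^ 2 = 0 :=
      le_antisymm (nonpos_of_mul_nonpos_right h7 hC) (by positivity)
    funext j
    have := (Finset.sum_eq_zero_iff_of_nonneg fun j _ => sq_nonneg ‖b j‖).1 h8 j
      (Finset.mem_univ j)
    simpa using this
  have h9 := LinearMap.finrank_le_finrank_of_injective hT
  simp only [Module.finrank_fintype_fun_eq_card, Fintype.card_fin, Fintype.card_coe] at h9
  rw [hF.encard_eq_coe_toFinset_card]
  exact_mod_cast h9

/-! ### Decomposition of a multi-tile into tiles -/

open scoped Classical in
/-- Every rank `j < #F` is attained by exactly one element of a finite set `F`. -/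
lemma existsUnique_card_filter_lt {α β : Type*} [LinearOrder α] {φ : β → α}
    (hφ : Function.Injective φ) (F : Finset β) {j : ℕ} (hj : j < F.card) :
    ∃! a, a ∈ F ∧ (F.filter fun b => φ b < φ a).card = j := by
  have hmono : ∀ a ∈ F, ∀ a', φ a < φ a' →
      (F.filter fun b => φ b < φ a).card < (F.filter fun b => φ b < φ a').card := by
    intro a ha a' h
    refine Finset.card_lt_card (Finset.ssubset_iff_of_subset ?_ |>.2 ⟨a, ?_, ?_⟩)
    · exact Finset.monotone_filter_right F fun b _ hb => lt_trans hb h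
    · simp [ha, h]
    · simp
  have hinj : Set.InjOn (fun a => (F.filter fun b => φ b < φ a).card) (F : Set β) := by
    intro a ha a' ha' h
    by_contra hne
    rcases lt_or_gt_of_ne (hφ.ne hne) with h' | h'
    · exact (hmono a ha a' h').ne h
    · exact (hmono a' ha' a h').ne h.symm
  have hmaps : Set.MapsTo (fun a => (F.filter fun b => φ b < φ a).card) (F : Set β)
      (Finset.range F.card : Set ℕ) := by
    intro a ha
    simp only [Finset.coe_range, Set.mem_Iio]
    exact Finset.card_lt_card (Finset.filter_ssubset.2 ⟨a, ha, lt_irrefl _⟩)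
  have hsurj := Finset.surjOn_of_injOn_of_card_le _ hmaps hinj (by simp)
  obtain ⟨a, ha, haj⟩ := hsurj (Finset.mem_coe.2 (Finset.mem_range.2 hj))
  exact ⟨a, ⟨ha, haj⟩, fun a' ha' => hinj ha'.1 ha (ha'.2.trans haj.symm)⟩

open scoped Classical in
/-- The number of points of the orbit `x + ℤⁿ` that lie in `Ω` and precede `x` in the
lexicographic order of `ℤⁿ`. -/
def orbitRank (Ω : Set (E n)) (x : E n) : ℝ≥0∞ :=
  ∑' k : Fin n → ℤ, if toLex k < 0 then Ω.indicator (fun _ => (1 : ℝ≥0∞)) (x + intVec k) else 0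

lemma measurable_orbitRank {Ω : Set (E n)} (hΩ : MeasurableSet Ω) : Measurable (orbitRank Ω) := by
  refine Measurable.tsum fun k => ?_
  split_ifs
  · exact (measurable_const.indicator hΩ).comp (measurable_id.add_const (intVec k))
  · exact measurable_const

open scoped Classical in
lemma orbitRank_add_intVec {Ω : Set (E n)} {x : E n} {F : Finset (Fin n → ℤ)}
    (hF : ∀ k, k ∈ F ↔ x + intVec k ∈ Ω) (k : Fin n → ℤ) :
    orbitRank Ω (x + intVec k) = (F.filter fun m => toLex m < toLex k).card := by
  have h : ∀ m : Fin n → ℤ, (if toLex (m - k) < 0 then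
      Ω.indicator (fun _ => (1 : ℝ≥0∞)) (x + intVec k + intVec (m - k)) else 0) =
      if m ∈ F.filter fun m => toLex m < toLex k then 1 else 0 := by
    intro m
    have e : x + intVec k + intVec (m - k) = x + intVec m := by
      rw [add_assoc, ← intVec_add, add_sub_cancel]
    rw [e, toLex_sub, sub_neg]
    simp only [Set.indicator_apply, ← hF, Finset.mem_filter, ite_and]
    split_ifs <;> rfl
  rw [orbitRank, ← (Equiv.subRight k).tsum_eq]
  simp only [Equiv.subRight_apply, h]
  rw [tsum_eq_sum (s := F.filter fun m => toLex m < toLex k) fun m hm => if_neg hm,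
    Finset.sum_congr rfl fun m hm => if_pos hm]
  simp

/-- The points of `Ω` that are preceded by exactly `j` points of `Ω` in their orbit. -/
def layer (Ω : Set (E n)) (j : ℕ) : Set (E n) := Ω ∩ {x | orbitRank Ω x = j}

lemma measurableSet_layer {Ω : Set (E n)} (hΩ : MeasurableSet Ω) (j : ℕ) :
    MeasurableSet (layer Ω j) :=
  hΩ.inter (measurable_orbitRank hΩ (measurableSet_singleton _))

lemma disjoint_layer (Ω : Set (E n)) {i j : ℕ} (hij : i ≠ j) :
    Disjoint (layer Ω i) (layer Ω j) := by
  refine Set.disjoint_left.2 fun x hi hj => hij ?_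
  have := hi.2.symm.trans hj.2
  exact_mod_cast this

lemma isTile_layer {ℓ : ℕ} {Ω : Set (E n)} (hΩ : MeasurableSet Ω)
    (h : ∀ᵐ x, {k : Fin n → ℤ | x + intVec k ∈ Ω}.encard = ℓ) {j : ℕ} (hj : j < ℓ) :
    IsTile (layer Ω j) := by
  refine ⟨measurableSet_layer hΩ j, ?_⟩
  filter_upwards [h] with x hx
  have hfin : {k : Fin n → ℤ | x + intVec k ∈ Ω}.Finite := Set.finite_of_encard_eq_coe hx
  have hcard : hfin.toFinset.card = ℓ := by
    rw [hfin.encard_eq_coe_toFinset_card] at hx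
    exact_mod_cast hx
  have := existsUnique_card_filter_lt (toLex (α := Fin n → ℤ)).injective hfin.toFinset
    (hcard.symm ▸ hj)
  refine (existsUnique_congr fun k => ?_).1 this
  rw [layer, Set.mem_inter_iff, Set.mem_ofPred_eq,
    orbitRank_add_intVec (Ω := Ω) (F := hfin.toFinset) (fun k => hfin.mem_toFinset), hfin.mem_toFinset,
    Nat.cast_inj]
  refine and_congr Iff.rfl ?_
  convert Iff.rfl
  rfl

open scoped Classical in
lemma ae_exists_mem_layer {ℓ : ℕ} {Ω : Set (E n)}
    (h : ∀ᵐ x, {k : Fin n → ℤ | x + intVec k ∈ Ω}.encard = ℓ) :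
    ∀ᵐ x, x ∈ Ω → ∃ j < ℓ, x ∈ layer Ω j := by
  filter_upwards [h] with x hx hxΩ
  have hfin : {k : Fin n → ℤ | x + intVec k ∈ Ω}.Finite := Set.finite_of_encard_eq_coe hx
  have hcard : hfin.toFinset.card = ℓ := by
    rw [hfin.encard_eq_coe_toFinset_card] at hx
    exact_mod_cast hx
  have h0 := orbitRank_add_intVec (Ω := Ω) (F := hfin.toFinset) (fun k => hfin.mem_toFinset) 0
  rw [intVec_zero, add_zero] at h0
  refine ⟨_, ?_, hxΩ, h0⟩
  rw [← hcard]
  refine Finset.card_lt_card (Finset.filter_ssubset.2 ⟨0, ?_, lt_irrefl _⟩)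
  rw [hfin.mem_toFinset]
  change x + intVec 0 ∈ Ω
  rwa [intVec_zero, add_zero]

/-! ### Orthonormal bases of modulations -/

/-- On a tile `D`, the integer modulations of `χ_D` are complete: every measurable subset of `D` is
the intersection of `D` with a periodic set. -/
lemma IsTile.ae_eq_zero_of_inner_eq_zero {D : Set (E n)} (hD : IsTile D) {f : L2 n}
    (h : ∀ k : Fin n → ℤ, inner ℂ (modulation (intVec k)
      (indicatorL2 D hD.measurableSet hD.volume_ne_top)) f = 0) :
    ∀ᵐ x, x ∈ D → f x = 0 := by
  set u := indicatorL2 D hD.measurableSet hD.volume_ne_top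
  have hint : ∀ S : Set (E n), MeasurableSet S → ∫ x in S ∩ D, f x = 0 := by
    intro S hS
    set A : Set (E n) := ⋃ k : Fin n → ℤ, (fun x => x + intVec k) ⁻¹' (S ∩ D)
    have hA : MeasurableSet A := MeasurableSet.iUnion fun k =>
      (hS.inter hD.measurableSet).preimage (measurable_id.add_const (intVec k))
    have hper : ∀ (k : Fin n → ℤ) x, x + intVec k ∈ A ↔ x ∈ A := by
      intro k x
      simp only [A, Set.mem_iUnion, Set.mem_preimage, add_assoc, ← intVec_add]
      constructor
      · rintro ⟨m, hm⟩
        exact ⟨k + m, hm⟩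
      · rintro ⟨m, hm⟩
        exact ⟨m - k, by rwa [add_sub_cancel]⟩
    have hfin : volume (S ∩ D) ≠ ∞ :=
      ne_top_of_le_ne_top hD.volume_ne_top (measure_mono Set.inter_subset_right)
    have hcut : cutoff A hA u = indicatorL2 (S ∩ D) (hS.inter hD.measurableSet) hfin := by
      ext1
      filter_upwards [coeFn_cutoff A hA u, coeFn_indicatorL2 D hD.measurableSet hD.volume_ne_top,
        coeFn_indicatorL2 (S ∩ D) (hS.inter hD.measurableSet) hfin, hD.ae_existsUnique]
        with x h1 h2 h3 h4
      rw [h1, h3]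
      change u x = _ at h2
      have hiff : x ∈ A ∧ x ∈ D ↔ x ∈ S ∩ D := by
        constructor
        · rintro ⟨hxA, hxD⟩
          obtain ⟨k, hk⟩ := Set.mem_iUnion.1 hxA
          have : k = 0 := h4.unique hk.2 (by rwa [intVec_zero, add_zero])
          rw [this, intVec_zero] at hk
          simpa using hk
        · intro hx
          exact ⟨Set.mem_iUnion.2 ⟨0, by simpa [intVec_zero] using hx⟩, hx.2⟩
      by_cases hx : x ∈ S ∩ D
      · rw [Set.indicator_of_mem hx, Set.indicator_of_mem (hiff.2 hx).1, h2,
          Set.indicator_of_mem hx.2]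
      · rw [Set.indicator_of_notMem hx]
        by_cases hxA : x ∈ A
        · rw [Set.indicator_of_mem hxA, h2,
            Set.indicator_of_notMem fun hxD => hx (hiff.1 ⟨hxA, hxD⟩)]
        · rw [Set.indicator_of_notMem hxA]
    have hzero : inner ℂ (cutoff A hA u) f = 0 := by
      have hcl : IsClosed {p : L2 n × L2 n | inner ℂ p.1 f = 0} :=
        isClosed_eq (continuous_fst.inner continuous_const) continuous_const
      have := closure_minimal (t := {p : L2 n × L2 n | inner ℂ p.1 f = 0}) ?_ hcl
        (cutoff_mem_closure_trigMul hA hper u u)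
      · exact this
      · rintro _ ⟨c, rfl⟩
        change inner ℂ (trigMul c u) f = 0
        rw [trigMul, Finsupp.sum, sum_inner]
        exact Finset.sum_eq_zero fun k _ => by rw [inner_smul_left, h k, mul_zero]
    rw [hcut, indicatorL2, L2.inner_indicatorConstLp_one] at hzero
    exact hzero
  have h0 : D.indicator f =ᵐ[volume] 0 := by
    refine ae_eq_zero_of_forall_setIntegral_eq_of_sigmaFinite (fun S hS hfin => ?_)
      fun S hS _ => ?_
    · have : IsFiniteMeasure ((volume : Measure (E n)).restrict S) := ⟨by simpa using hfin⟩
      exact (((Lp.memLp f).indicator hD.measurableSet).restrict S).integrable one_le_two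
    · rw [setIntegral_indicator hD.measurableSet, hint S hS]
  filter_upwards [h0] with x hx hxD
  rwa [Set.indicator_of_mem hxD] at hx

lemma _root_.Submodule.eq_of_le_of_forall_inner_eq_zero {H : Type*} [NormedAddCommGroup H]
    [InnerProductSpace ℂ H] [CompleteSpace H] {K W : Submodule ℂ H} (hK : IsClosed (K : Set H))
    (hKW : K ≤ W) (h : ∀ f ∈ W, (∀ u ∈ K, inner ℂ u f = 0) → f = 0) : K = W := by
  have : CompleteSpace K := hK.completeSpace_coe
  refine le_antisymm hKW fun f hf => ?_
  have h0 := h (f - K.starProjection f)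
    (sub_mem hf (hKW (Submodule.starProjection_apply_mem _ _)))
    fun u hu => Submodule.inner_right_of_mem_orthogonal hu
      (Submodule.sub_starProjection_mem_orthogonal f)
  rw [sub_eq_zero.1 h0]
  exact Submodule.starProjection_apply_mem _ _

lemma _root_.Orthonormal.isRieszBasis {ι H : Type*} [NormedAddCommGroup H]
    [InnerProductSpace ℂ H] {v : ι → H} (hv : Orthonormal ℂ v) {V : Submodule ℂ H}
    (hV : (Submodule.span ℂ (Set.range v)).topologicalClosure = V) : IsRieszBasis v V := by
  refine ⟨hV, 1, 1, one_pos, le_rfl, fun c => ?_⟩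
  rw [hv.norm_sq_finsupp_sum, one_mul]
  exact ⟨le_rfl, le_rfl⟩

lemma indicatorL2_mem_supportedOn (D : Set (E n)) (hD : MeasurableSet D) (h : volume D ≠ ∞) :
    indicatorL2 D hD h ∈ supportedOn D := by
  refine mem_supportedOn.2 ?_
  filter_upwards [coeFn_indicatorL2 D hD h] with x hx hxD
  rw [hx, Set.indicator_of_notMem hxD]

lemma supportedOn_mono {A B : Set (E n)} (h : A ⊆ B) : supportedOn A ≤ supportedOn B := by
  intro f hf
  filter_upwards [mem_supportedOn.1 hf] with x hx hxB
  exact hx fun hxA => hxB (h hxA)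

lemma inner_eq_zero_of_disjoint {A B : Set (E n)} (h : Disjoint A B) {f g : L2 n}
    (hf : f ∈ supportedOn A) (hg : g ∈ supportedOn B) : inner ℂ f g = 0 := by
  rw [L2.inner_def, ← integral_zero (E n) ℂ]
  refine integral_congr_ae ?_
  filter_upwards [mem_supportedOn.1 hf, mem_supportedOn.1 hg] with x h1 h2
  by_cases hx : x ∈ A
  · rw [h2 (Set.disjoint_left.1 h hx), inner_zero_right]
  · rw [h1 hx, inner_zero_left]

lemma orthonormal_modulation_of_pairwise_disjoint {ι : Type*} {D : ι → Set (E n)} {u : ι → L2 n}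
    (hu : ∀ j, u j ∈ supportedOn (D j)) (hdisj : Pairwise (Function.onFun Disjoint D))
    (h1 : ∀ j, Orthonormal ℂ fun k : Fin n → ℤ => modulation (intVec k) (u j)) :
    Orthonormal ℂ fun p : (Fin n → ℤ) × ι => modulation (intVec p.1) (u p.2) := by
  refine ⟨fun p => (h1 p.2).norm_eq_one p.1, ?_⟩
  rintro ⟨k, i⟩ ⟨m, j⟩ hne
  by_cases hij : i = j
  · subst hij
    exact (h1 i).inner_eq_zero fun hkm => hne (Prod.ext hkm rfl)
  · exact inner_eq_zero_of_disjoint (hdisj hij) (modulation_mem_supportedOn _ (hu i))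
      (modulation_mem_supportedOn _ (hu j))

/-- If almost every point of `Ω` lies in one of the pairwise disjoint tiles `D₁, …, D_ℓ ⊆ Ω`, then
the integer modulations of their indicator functions form a Riesz basis (even an orthonormal one)
of `L²(Ω)`. -/
lemma isRieszBasis_supportedOn_of_isTile {ι : Type*} [Countable ι] {D : ι → Set (E n)}
    (hD : ∀ j, IsTile (D j)) (hdisj : Pairwise (Function.onFun Disjoint D)) {Ω : Set (E n)}
    (hsub : ∀ j, D j ⊆ Ω) (hcov : ∀ᵐ x, x ∈ Ω → ∃ j, x ∈ D j) :
    IsRieszBasis (fun p : (Fin n → ℤ) × ι => modulation (intVec p.1)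
      (indicatorL2 (D p.2) (hD p.2).measurableSet (hD p.2).volume_ne_top)) (supportedOn Ω) := by
  have hg : ∀ j, indicatorL2 (D j) (hD j).measurableSet (hD j).volume_ne_top ∈ supportedOn (D j) :=
    fun j => indicatorL2_mem_supportedOn _ _ _
  refine (orthonormal_modulation_of_pairwise_disjoint hg hdisj
    fun j => (hD j).orthonormal).isRieszBasis ?_
  · refine Submodule.eq_of_le_of_forall_inner_eq_zero (Submodule.isClosed_topologicalClosure _) ?_ ?_
    · refine Submodule.topologicalClosure_minimal _ (Submodule.span_le.2 ?_)
        (isClosed_supportedOn Ω)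
      rintro _ ⟨⟨k, j⟩, rfl⟩
      exact supportedOn_mono (hsub j) (modulation_mem_supportedOn _ (hg j))
    · intro f hf horth
      have h1 : ∀ j, ∀ᵐ x, x ∈ D j → f x = 0 := fun j =>
        (hD j).ae_eq_zero_of_inner_eq_zero fun k =>
          horth _ (Submodule.le_topologicalClosure _ (Submodule.subset_span ⟨(k, j), rfl⟩))
      ext1
      filter_upwards [ae_all_iff.2 h1, hcov, mem_supportedOn.1 hf,
        Lp.coeFn_zero ℂ 2 (volume : Measure (E n))] with x h1 h2 h3 h4
      rw [h4, Pi.zero_apply]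
      by_cases hx : x ∈ Ω
      · obtain ⟨j, hxj⟩ := h2 hx
        exact h1 j hxj
      · exact h3 hx

/-- If almost every orbit meets `Ω` in exactly `ℓ` points, then `L²(Ω)` has a Riesz basis
consisting of the integer modulations of `ℓ` functions. -/
lemma exists_isRieszBasis_supportedOn {ℓ : ℕ} {Ω : Set (E n)} (hΩ : MeasurableSet Ω)
    (h : ∀ᵐ x, {k : Fin n → ℤ | x + intVec k ∈ Ω}.encard = ℓ) :
    ∃ g : Fin ℓ → L2 n, IsRieszBasis (fun p : (Fin n → ℤ) × Fin ℓ =>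
      modulation (intVec p.1) (g p.2)) (supportedOn Ω) := by
  have hT : ∀ j : Fin ℓ, IsTile (layer Ω j) := fun j => isTile_layer hΩ h j.2
  refine ⟨fun j => indicatorL2 (layer Ω j) (hT j).measurableSet (hT j).volume_ne_top,
    isRieszBasis_supportedOn_of_isTile (D := fun j : Fin ℓ => layer Ω j) hT
    (fun i j hij => disjoint_layer Ω (Fin.val_ne_of_ne hij)) (fun j => Set.inter_subset_left) ?_⟩
  filter_upwards [ae_exists_mem_layer h] with x hx hxΩ
  obtain ⟨j, hj, hxj⟩ := hx hxΩ
  exact ⟨⟨j, hj⟩, hxj⟩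

/-- A subspace of `L²(ℝⁿ)` has a Riesz basis of integer modulations of `ℓ` functions and is
invariant under all modulations if and only if it consists of all functions supported on a set
meeting almost every orbit of `ℤⁿ` in exactly `ℓ` points. -/
theorem exists_isRieszBasis_and_modulation_mem_iff {ℓ : ℕ} {W : Submodule ℂ (L2 n)} :
    ((∃ g : Fin ℓ → L2 n, IsRieszBasis (fun p : (Fin n → ℤ) × Fin ℓ =>
      modulation (intVec p.1) (g p.2)) W) ∧ ∀ s, ∀ f ∈ W, modulation s f ∈ W) ↔
    ∃ Ω : Set (E n), MeasurableSet Ω ∧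
      (∀ᵐ x, {k : Fin n → ℤ | x + intVec k ∈ Ω}.encard = ℓ) ∧ W = supportedOn Ω := by
  constructor
  · rintro ⟨⟨g, hspan, C₁, C₂, hC₁, -, hb⟩, hinv⟩
    have hcl : IsClosed (W : Set (L2 n)) := hspan ▸ Submodule.isClosed_topologicalClosure _
    obtain ⟨Ω, hΩ, rfl⟩ := exists_eq_supportedOn_of_modulation_mem W hcl hinv
    have hle := ae_encard_le (g := g) hΩ hspan.ge
    have hg : ∀ j, g j ∈ supportedOn Ω := by
      intro j
      have hmem : modulation (intVec 0) (g j) ∈ supportedOn Ω := by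
        rw [← hspan]
        exact Submodule.le_topologicalClosure _ (Submodule.subset_span ⟨(0, j), rfl⟩)
      filter_upwards [mem_supportedOn.1 hmem, coeFn_modulation (intVec 0) (g j)] with x h1 h2 hx
      have := h2.symm.trans (h1 hx)
      exact (mul_eq_zero.1 this).resolve_left (norm_ne_zero_iff.1 (by simp [norm_char]))
    refine ⟨Ω, hΩ, ?_, rfl⟩
    filter_upwards [hle, ae_le_encard hg hC₁ (fun c => (hb c).1) hle] with x h1 h2
    exact le_antisymm h1 h2
  · rintro ⟨Ω, hΩ, hcard, rfl⟩
    exact ⟨exists_isRieszBasis_supportedOn hΩ hcard, fun s f hf => modulation_mem_supportedOn s hf⟩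

/-! ### Riesz bases under isometries -/

lemma IsRieszBasis.map {ι H H' : Type*} [NormedAddCommGroup H] [InnerProductSpace ℂ H]
    [NormedAddCommGroup H'] [InnerProductSpace ℂ H'] {v : ι → H} {V : Submodule ℂ H}
    (hv : IsRieszBasis v V) (U : H ≃ₗᵢ[ℂ] H') :
    IsRieszBasis (fun i => U (v i)) (V.map U.toLinearEquiv.toLinearMap) := by
  obtain ⟨hspan, C₁, C₂, hC₁, hC, hb⟩ := hv
  refine ⟨?_, C₁, C₂, hC₁, hC, fun c => ?_⟩
  · rw [← hspan]
    have h1 : Set.range (fun i => U (v i)) = U.toLinearEquiv.toLinearMap '' Set.range v := by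
      rw [← Set.range_comp]; rfl
    rw [h1, ← Submodule.map_span]
    apply SetLike.coe_injective
    rw [Submodule.topologicalClosure_coe, Submodule.map_coe, Submodule.map_coe,
      Submodule.topologicalClosure_coe]
    exact (U.toHomeomorph.image_closure _).symm
  · have h1 : (c.sum fun i a => a • U (v i)) = U (c.sum fun i a => a • v i) := by
      simp only [Finsupp.sum, map_sum, map_smul]
    rw [h1, U.norm_map]
    exact hb c

lemma IsRieszBasis.smul_of_norm_eq_one {ι H : Type*} [NormedAddCommGroup H]
    [InnerProductSpace ℂ H] {v : ι → H} {V : Submodule ℂ H} (hv : IsRieszBasis v V) {z : ι → ℂ}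
    (hz : ∀ i, ‖z i‖ = 1) : IsRieszBasis (fun i => z i • v i) V := by
  obtain ⟨hspan, C₁, C₂, hC₁, hC, hb⟩ := hv
  have hz0 : ∀ i, z i ≠ 0 := fun i => norm_ne_zero_iff.1 (by rw [hz]; exact one_ne_zero)
  refine ⟨?_, C₁, C₂, hC₁, hC, fun c => ?_⟩
  · rw [← hspan]
    congr 1
    apply le_antisymm <;> rw [Submodule.span_le] <;> rintro _ ⟨i, rfl⟩
    · exact Submodule.smul_mem _ _ (Submodule.subset_span ⟨i, rfl⟩)
    · have : v i = (z i)⁻¹ • (z i • v i) := (inv_smul_smul₀ (hz0 i) _).symm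
      rw [SetLike.mem_coe, this]
      exact Submodule.smul_mem _ _ (Submodule.subset_span ⟨i, rfl⟩)
  · have h := hb (Finsupp.onFinset c.support (fun i => c i * z i)
      fun i hi => Finsupp.mem_support_iff.2 (left_ne_zero_of_mul hi))
    rw [Finsupp.onFinset_sum _ (by simp), Finsupp.onFinset_sum _ (by simp)] at h
    simpa only [Finsupp.sum, norm_mul, hz, mul_one, mul_smul] using h

/-! ### The chirped Fourier transform -/

lemma unimodularMul_surjective (u : E n → ℂ) (hu : Continuous u) (h1 : ∀ x, ‖u x‖ = 1) :
    Function.Surjective (unimodularMul u hu h1) := by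
  intro f
  have hc : Continuous fun x => (starRingEnd ℂ) (u x) := Complex.continuous_conj.comp hu
  have hc1 : ∀ x, ‖(starRingEnd ℂ) (u x)‖ = 1 := fun x => by rw [RCLike.norm_conj, h1]
  refine ⟨unimodularMul _ hc hc1 f, ?_⟩
  ext1
  filter_upwards [coeFn_unimodularMul u hu h1 (unimodularMul _ hc hc1 f),
    coeFn_unimodularMul _ hc hc1 f] with x h2 h3
  rw [h2, h3, ← mul_assoc, Complex.mul_conj, Complex.normSq_eq_norm_sq, h1]
  simp

/-- The chirp `t ↦ exp (-π i |t|² cot θ)`. -/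
def chirpPhase (θ : ℝ) (t : E n) : ℂ :=
  Complex.exp (((-(Real.pi * ‖t‖ ^ 2 * Real.cot θ) : ℝ) : ℂ) * Complex.I)

lemma continuous_chirpPhase (θ : ℝ) : Continuous (chirpPhase θ : E n → ℂ) := by
  unfold chirpPhase
  fun_prop

lemma norm_chirpPhase (θ : ℝ) (t : E n) : ‖chirpPhase θ t‖ = 1 :=
  Complex.norm_exp_ofReal_mul_I _

lemma chirpPhase_ne_zero (θ : ℝ) (t : E n) : chirpPhase θ t ≠ 0 := Complex.exp_ne_zero _

/-- The unitary operator `f ↦ 𝓕⁻¹ (exp (-π i |t|² cot θ) f)`, of which the fractional Fourier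
transform is a dilation, up to a unimodular factor. -/
def chirpFourier (n : ℕ) (θ : ℝ) : L2 n ≃ₗᵢ[ℂ] L2 n :=
  (LinearIsometryEquiv.ofSurjective
    (unimodularMul (chirpPhase θ) (continuous_chirpPhase θ) (norm_chirpPhase θ))
    (unimodularMul_surjective _ _ _)).trans (Lp.fourierTransformₗᵢ (E n) ℂ).symm

lemma chirpFourier_apply (θ : ℝ) (f : L2 n) : chirpFourier n θ f = 𝓕⁻ (chirp θ f) := rfl

/-- Translation by `s` on `L²(ℝⁿ)`. -/
def translation (s : E n) : L2 n →ₗᵢ[ℂ] L2 n :=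
  Lp.compMeasurePreservingₗᵢ ℂ (fun t => t - s) (measurePreserving_sub_right volume s)

lemma coeFn_translation (s : E n) (f : L2 n) :
    translation s f =ᵐ[volume] fun t => f (t - s) :=
  Lp.coeFn_compMeasurePreserving f (measurePreserving_sub_right volume s)

lemma dense_integrable : Dense {f : L2 n | Integrable f} := by
  refine (SchwartzMap.denseRange_toLpCLM (F := ℂ) (E := E n) (p := 2)
    (μ := volume) ENNReal.ofNat_ne_top).mono ?_
  rintro _ ⟨φ, rfl⟩
  exact φ.integrable.congr (φ.coeFn_toLp 2 volume).symm

lemma fourierInv_translation (s : E n) (f : L2 n) :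
    (𝓕⁻ (translation s f) : L2 n) = modulation s (𝓕⁻ f) := by
  have hl : Continuous fun f : L2 n => (𝓕⁻ (translation s f) : L2 n) :=
    (Lp.fourierTransformₗᵢ (E n) ℂ).symm.continuous.comp (translation s).continuous
  have hr : Continuous fun f : L2 n => modulation s (𝓕⁻ f : L2 n) :=
    (modulation s).continuous.comp (Lp.fourierTransformₗᵢ (E n) ℂ).symm.continuous
  refine congrFun (Continuous.ext_on dense_integrable hl hr fun f hf => ?_) f
  have hf : Integrable f := hf
  have htr : Integrable (translation s f) := (hf.comp_sub_right s).congr (coeFn_translation s f).symm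
  ext1
  filter_upwards [fourierInv_ae_eq_integral _ htr, fourierInv_ae_eq_integral f hf,
    coeFn_modulation s (𝓕⁻ f)] with ξ h1 h2 h3
  rw [h1, h3, h2, Real.fourierInv_eq', Real.fourierInv_eq', ← integral_const_mul,
    ← integral_sub_right_eq_self (fun t => char s ξ * _) s]
  refine integral_congr_ae ?_
  filter_upwards [coeFn_translation s f] with t ht
  rw [ht, smul_eq_mul, smul_eq_mul, ← mul_assoc, char, ← Complex.exp_add, inner_sub_left]
  congr 2
  push_cast
  ring

/-- The chirped Fourier transform turns `θ`-translations into modulations, up to a constant phase: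
completing the square, `chirp θ (T_s^θ f)` is a constant multiple of the translate of
`chirp θ f`. -/
lemma chirpFourier_thetaTranslate (θ : ℝ) (s : E n) (f : L2 n) :
    chirpFourier n θ (thetaTranslate θ s f) =
      chirpPhase θ s • modulation s (chirpFourier n θ f) := by
  have h : chirp θ (thetaTranslate θ s f) = chirpPhase θ s • translation s (chirp θ f) := by
    ext1
    filter_upwards [(memLp_chirpFun θ (thetaTranslate θ s f)).coeFn_toLp,
      (memLp_thetaTranslateFun θ s f).coeFn_toLp,
      Lp.coeFn_smul (chirpPhase θ s) (translation s (chirp θ f)), coeFn_translation s (chirp θ f),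
      (measurePreserving_sub_right volume s).quasiMeasurePreserving.ae
        (memLp_chirpFun θ f).coeFn_toLp] with t h1 h2 h3 h4 h5
    have h1' : chirp θ (thetaTranslate θ s f) t = chirpFun θ (thetaTranslate θ s f) t := h1
    have h2' : thetaTranslate θ s f t = thetaTranslateFun θ s f t := h2
    have h5' : chirp θ f (t - s) = chirpFun θ f (t - s) := h5
    rw [h1', h3, Pi.smul_apply, h4, h5', chirpFun, h2', thetaTranslateFun, chirpFun, chirpPhase,
      smul_eq_mul, ← mul_assoc, ← mul_assoc, ← Complex.exp_add, ← Complex.exp_add]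
    congr 2
    rw [← add_mul, ← add_mul, ← Complex.ofReal_add, ← Complex.ofReal_add]
    congr 2
    rw [norm_sub_sq_real, inner_sub_right, real_inner_self_eq_norm_sq, real_inner_comm]
    ring
  rw [chirpFourier_apply, h, FourierTransform.fourierInv_smul, fourierInv_translation]
  rfl

/-! ### Dilations -/

lemma ae_inv_smul_iff {a : ℝ} (ha : a ≠ 0) {p : E n → Prop} :
    (∀ᵐ x, p (a⁻¹ • x)) ↔ ∀ᵐ x, p x := by
  have hq : ∀ {b : ℝ}, b ≠ 0 →
      Measure.QuasiMeasurePreserving (fun x : E n => b • x) volume volume := by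
    intro b hb
    refine ⟨by fun_prop, ?_⟩
    rw [Measure.map_addHaar_smul _ hb]
    exact Measure.smul_absolutelyContinuous
  constructor
  · intro h
    filter_upwards [(hq ha).ae h] with x hx
    rwa [inv_smul_smul₀ ha] at hx
  · exact fun h => (hq (inv_ne_zero ha)).ae h

lemma bandlimited_eq {θ : ℝ} (hθ : Real.sin θ ≠ 0) (Ω : Set (E n)) :
    bandlimited θ Ω =
      {f | chirpFourier n θ f ∈ supportedOn {ξ | Real.sin θ • ξ ∈ Ω}} := by
  ext f
  rw [Set.mem_ofPred_eq, mem_supportedOn, ← ae_inv_smul_iff hθ]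
  change (∀ᵐ ω, ω ∉ Ω → frft θ f ω = 0) ↔ _
  refine eventually_congr (Eventually.of_forall fun ω => ?_)
  have h0 : ((|Real.sin θ| ^ (-(n : ℝ) / 2) : ℝ) : ℂ) ≠ 0 :=
    Complex.ofReal_ne_zero.2 (Real.rpow_pos_of_pos (abs_pos.2 hθ) _).ne'
  have h1 : frft θ f ω = 0 ↔ chirpFourier n θ f ((Real.sin θ)⁻¹ • ω) = 0 := by
    rw [frft, mul_eq_zero, or_iff_right h0, chirpFun, mul_eq_zero,
      or_iff_right (Complex.exp_ne_zero _)]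
    rfl
  rw [h1, Set.mem_ofPred_eq, smul_inv_smul₀ hθ]

lemma isFractionalMultiTile_iff {θ : ℝ} (hθ : Real.sin θ ≠ 0) {ℓ : ℕ} {Ω : Set (E n)} :
    IsFractionalMultiTile θ ℓ Ω ↔
      ∀ᵐ ξ : E n, {k : Fin n → ℤ | ξ + intVec k ∈ {ξ | Real.sin θ • ξ ∈ Ω}}.encard = ℓ := by
  rw [IsFractionalMultiTile, TilesAtLevel, ← ae_inv_smul_iff hθ (p := fun ξ : E n =>
    {k : Fin n → ℤ | ξ + intVec k ∈ {ξ | Real.sin θ • ξ ∈ Ω}}.encard = ℓ)]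
  refine eventually_congr (Eventually.of_forall fun ω => ?_)
  have hinj : Function.Injective fun k : Fin n → ℤ => Real.sin θ • (intVec k : E n) :=
    (smul_right_injective (E n) hθ).comp intVec_injective
  set S := {k : Fin n → ℤ | (Real.sin θ)⁻¹ • ω + intVec k ∈ {ξ | Real.sin θ • ξ ∈ Ω}}
  have h : ∑' t : lattice n θ, Ω.indicator (fun _ => (1 : ℝ≥0∞)) (ω + t) = (S.encard : ℝ≥0∞) := by
    rw [← ENNReal.tsum_set_one, tsum_subtype S fun _ => (1 : ℝ≥0∞)]
    refine ((Equiv.ofInjective _ hinj).tsum_eq fun t : lattice n θ =>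
      Ω.indicator (fun _ => (1 : ℝ≥0∞)) (ω + t)).symm.trans (tsum_congr fun k => ?_)
    have hiff : k ∈ S ↔ ω + Real.sin θ • intVec k ∈ Ω := by
      simp only [S, Set.mem_ofPred_eq, smul_add, smul_inv_smul₀ hθ]
    rw [Equiv.ofInjective_apply]
    by_cases hk : k ∈ S
    · rw [Set.indicator_of_mem hk, Set.indicator_of_mem (hiff.1 hk)]
    · rw [Set.indicator_of_notMem hk, Set.indicator_of_notMem fun h => hk (hiff.2 h)]
  rw [h]
  constructor
  · intro h
    exact_mod_cast h
  · intro h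
    rw [h]
    rfl

/-! ### Transfer to the fractional Fourier transform -/

lemma chirpFourier_mem_map {θ : ℝ} {V : Submodule ℂ (L2 n)} {f : L2 n} :
    chirpFourier n θ f ∈ V.map (chirpFourier n θ).toLinearEquiv.toLinearMap ↔ f ∈ V := by
  refine ⟨?_, fun hf => ⟨f, hf, rfl⟩⟩
  rintro ⟨g, hg, h⟩
  exact (chirpFourier n θ).injective h ▸ hg

lemma isThetaTranslationInvariant_iff {θ : ℝ} {V : Submodule ℂ (L2 n)} :
    IsThetaTranslationInvariant θ V ↔
      ∀ s, ∀ g ∈ V.map (chirpFourier n θ).toLinearEquiv.toLinearMap,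
        modulation s g ∈ V.map (chirpFourier n θ).toLinearEquiv.toLinearMap := by
  have key : ∀ s f, thetaTranslate θ s f ∈ V ↔ modulation s (chirpFourier n θ f) ∈
      V.map (chirpFourier n θ).toLinearEquiv.toLinearMap := by
    intro s f
    rw [← chirpFourier_mem_map (θ := θ), chirpFourier_thetaTranslate, Submodule.smul_mem_iff _ (chirpPhase_ne_zero θ s)]
  constructor
  · rintro h s _ ⟨f, hf, rfl⟩
    exact (key s f).1 (h s f hf)
  · intro h s f hf
    exact (key s f).2 (h s _ (chirpFourier_mem_map.2 hf))

lemma mem_𝒯_iff {ℓ : ℕ} {θ : ℝ} {V : Submodule ℂ (L2 n)} :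
    V ∈ 𝒯 n ℓ θ ↔ ∃ g : Fin ℓ → L2 n, IsRieszBasis (fun p : (Fin n → ℤ) × Fin ℓ =>
      modulation (intVec p.1) (g p.2)) (V.map (chirpFourier n θ).toLinearEquiv.toLinearMap) := by
  have hz : ∀ s : E n, chirpPhase θ s ≠ 0 := chirpPhase_ne_zero θ
  constructor
  · rintro ⟨φ, hφ⟩
    refine ⟨fun j => chirpFourier n θ (φ j), ?_⟩
    have h := (hφ.map (chirpFourier n θ)).smul_of_norm_eq_one
      (z := fun p => (chirpPhase θ (intVec p.1))⁻¹) (fun p => by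
        rw [norm_inv, norm_chirpPhase, inv_one])
    simpa only [chirpFourier_thetaTranslate, inv_smul_smul₀ (hz _)] using h
  · rintro ⟨g, hg⟩
    refine ⟨fun j => (chirpFourier n θ).symm (g j), ?_⟩
    have h := (hg.smul_of_norm_eq_one (z := fun p => chirpPhase θ (intVec p.1))
      (fun p => norm_chirpPhase θ _)).map (chirpFourier n θ).symm
    have hV : (V.map (chirpFourier n θ).toLinearEquiv.toLinearMap).map
        (chirpFourier n θ).symm.toLinearEquiv.toLinearMap = V := by
      rw [← Submodule.map_comp]
      convert Submodule.map_id V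
      ext1 f
      exact (chirpFourier n θ).symm_apply_apply f
    rw [hV] at h
    refine (congrArg (IsRieszBasis · V) (funext fun p => ?_)).mp h
    rw [LinearIsometryEquiv.symm_apply_eq, chirpFourier_thetaTranslate,
      LinearIsometryEquiv.apply_symm_apply]

end FrFT

end

theorem proposition4p8 (n ℓ : ℕ) (θ : ℝ) (hθ : Real.sin θ ≠ 0)
    (V : Submodule ℂ (FrFT.L2 n)) :
    (V ∈ FrFT.𝒯 n ℓ θ ∧ FrFT.IsThetaTranslationInvariant θ V) ↔
      ∃ Ω : Set (FrFT.E n), MeasurableSet Ω ∧ FrFT.IsFractionalMultiTile θ ℓ Ω ∧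
        (V : Set (FrFT.L2 n)) = FrFT.bandlimited θ Ω := by
  rw [FrFT.mem_𝒯_iff, FrFT.isThetaTranslationInvariant_iff,
    FrFT.exists_isRieszBasis_and_modulation_mem_iff]
  have hV : ∀ Ω : Set (FrFT.E n), V.map (FrFT.chirpFourier n θ).toLinearEquiv.toLinearMap =
      FrFT.supportedOn {ξ | Real.sin θ • ξ ∈ Ω} ↔ (V : Set (FrFT.L2 n)) = FrFT.bandlimited θ Ω := by
    intro Ω
    rw [FrFT.bandlimited_eq hθ, SetLike.ext_iff, Set.ext_iff,
      (FrFT.chirpFourier n θ).surjective.forall]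
    exact forall_congr' fun f => iff_congr FrFT.chirpFourier_mem_map Iff.rfl
  constructor
  · rintro ⟨Ω, hΩ, hcard, h⟩
    have hdil : {ξ : FrFT.E n | Real.sin θ • ξ ∈ {ω | (Real.sin θ)⁻¹ • ω ∈ Ω}} = Ω := by
      ext ξ
      simp only [Set.mem_ofPred_eq, inv_smul_smul₀ hθ]
    refine ⟨{ω | (Real.sin θ)⁻¹ • ω ∈ Ω}, hΩ.preimage (measurable_const_smul _), ?_, ?_⟩
    · rwa [FrFT.isFractionalMultiTile_iff hθ, hdil]
    · rwa [← hV, hdil]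
  · rintro ⟨Ω, hΩ, htile, h⟩
    exact ⟨{ξ | Real.sin θ • ξ ∈ Ω}, hΩ.preimage (measurable_const_smul _),
      (FrFT.isFractionalMultiTile_iff hθ).1 htile, (hV Ω).2 h⟩
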